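/- Let $(a_n)_{n\ge1}$ be a sequence of positive real numbers. Let $T_1$ be a closed segment of length $a_1$, rooted at one of its two extremities, and recursively, for $n\ge2$, let $T_n$ be the tree obtained from $T_{n-1}$ by gluing one extremity of a closed segment of length $a_n$ on a point which, given $T_{n-1}$, is chosen uniformly on $T_{n-1}$ (i.e. according to the normalized length measure). Let $d$ denote the length metric of $T_n$. For each $n\ge1$, given $T_n$, let $X_n$ be a uniformly chosen point of $T_n$, and let $D_n=d(X_n,\mathrm{root})$. Assume that $(a_n)$ is regularly varying with index $\alpha\ge0$, i.e. $a_{\lfloor cn\rfloor}/a_n\to c^{\alpha}$ as $n\to\infty$ for every $c>0$. Then, as $n\to\infty$: 1. If $\alpha>0$, then $$\frac{D_n}{\sum_{i=1}^n i^{-1}a_i}\longrightarrow \alpha\,\xi_{(\alpha)}\quad\text{in distribution},$$ where $\xi_{(\alpha)}$ is a real random variable whose law exists and is uniquely characterized by $$\mathbb E\big[e^{\lambda\xi_{(\alpha)}}\big]=\exp\Big(\frac{\alpha+1}{\alpha}\int_0^1\big(e^{\lambda u}-1\big)\frac{1-u}{u}\,\mathrm du\Big),\qquad \lambda\in\mathbb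 R.$$ 2. If $\alpha=0$ and $\sum_{i\ge1} i^{-1}a_i=\infty$, then $$\frac{D_n}{\sum_{i=1}^n i^{-1}a_i}\longrightarrow \frac12\quad\text{in probability}.$$ 3. If $\alpha=0$ and $\sum_{i\ge1} i^{-1}a_i<\infty$, then there is an almost surely positive random variable $D_\infty$ with finite expectation such that $$\frac{D_n}{\sum_{i=1}^n i^{-1}a_i}\longrightarrow D_\infty\quad\text{in distribution}.$$ -/

import Mathlib

open MeasureTheory ProbabilityTheory Filter Topology

noncomputable section

namespace SegmentGluing

/-- A positive sequence `(a n)_{n ≥ 1}` is regularly varying with index `α` if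
`a ⌊c n⌋ / a n → c ^ α` for every `c > 0`. (The value `a 0` plays no role.) -/
def RegularlyVarying (a : ℕ → ℝ) (α : ℝ) : Prop :=
  ∀ c : ℝ, 0 < c → Tendsto (fun n : ℕ => a ⌊c * n⌋₊ / a n) atTop (𝓝 (c ^ α))

/-- The normalizing sum `∑_{i=1}^n i⁻¹ a i`. -/
def weightedSum (a : ℕ → ℝ) (n : ℕ) : ℝ := ∑ i ∈ Finset.Icc 1 n, (i : ℝ)⁻¹ * a i

/-- The point of the `i`-th segment at distance `t ∈ [0, a i]` from its glued extremity is written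
`(i, t)`. Hence `T_n` is the set of `(i, t)` with `1 ≤ i ≤ n` and `0 ≤ t ≤ a i`, where the
extremity `(i + 1, 0)` is identified with the point `y i` of `T_i` on which the segment of index
`i + 1` is glued, `i ≥ 1` (these two points are at distance `0` for `treeDist`). -/
abbrev Pt : Type := ℕ × ℝ

/-- The length metric of `T_n`, when the segment of index `i + 1` is glued on `y i`, `i ≥ 1`.
It extends the metric of `T_{n-1}`; two points of the last segment are at their distance along
this segment; and the path between a point `(n, t)` of the last segment and a point `q` of
`T_{n-1}` runs through the gluing point. -/
def treeDist (y : ℕ → Pt) : ℕ → Pt → Pt → ℝ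
  | 0, _, _ => 0
  | n + 1, p, q =>
    if p.1 = n + 1 then
      if q.1 = n + 1 then |p.2 - q.2| else p.2 + treeDist y n (y n) q
    else
      if q.1 = n + 1 then treeDist y n p (y n) + q.2 else treeDist y n p q

/-- The root: the first extremity of the first segment. -/
def root : Pt := (1, 0)

/-- The length measure of `T_n`. -/
def lengthMeasure (a : ℕ → ℝ) (n : ℕ) : Measure Pt :=
  ∑ i ∈ Finset.Icc 1 n, (volume.restrict (Set.Icc 0 (a i))).map (fun t : ℝ => ((i, t) : Pt))

/-- The uniform probability measure on `T_n`: the length measure divided by its total mass. -/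
def uniformLaw (a : ℕ → ℝ) (n : ℕ) : Measure Pt :=
  (lengthMeasure a n Set.univ)⁻¹ • lengthMeasure a n

variable {Ω : Type*} [MeasurableSpace Ω]

/-- Given the tree `T_n`, that is, given the gluing points `Y 1, …, Y (n - 1)`, the point `Z` is
uniform on `T_n`. (In the coordinates `(i, t)` the uniform measure of `T_n` does not depend on the
positions of the gluing points, so the conditional law is a constant kernel.) -/
def UniformOnTree (a : ℕ → ℝ) (P : Measure Ω) (Y : ℕ → Ω → Pt) (n : ℕ) (Z : Ω → Pt) : Prop :=
  HasCondDistrib Z (fun ω (i : Finset.Ico 1 n) => Y i ω)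
    (Kernel.const (Finset.Ico 1 n → Pt) (uniformLaw a n)) P

/-- `Y` is a sequence of gluing points: for every `n ≥ 1`, the segment of index `n + 1` is glued on
`Y n`, which is uniform on `T_n` given `T_n`. -/
def IsGluing (a : ℕ → ℝ) (P : Measure Ω) (Y : ℕ → Ω → Pt) : Prop :=
  ∀ n, 1 ≤ n → UniformOnTree a P Y n (Y n)

/-- The height `D_n = d(X_n, root)` of the marked point `X n` of `T_n`. -/
def height (Y X : ℕ → Ω → Pt) (n : ℕ) (ω : Ω) : ℝ :=
  treeDist (fun i => Y i ω) n (X n ω) root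

/-- `φ_α(t) = (α + 1) / α * ∫_0^1 (exp (t u) - 1) (1 - u) / u du`. -/
def phi (α t : ℝ) : ℝ :=
  (α + 1) / α * ∫ u in (0 : ℝ)..1, (Real.exp (t * u) - 1) * ((1 - u) / u)

/-- `ν` is the law of `ξ_(α)`: its moment generating function is `exp ∘ φ_α` on all of `ℝ`.
(As `mgf` is `0` where the exponential is not integrable, this contains the finiteness of all
exponential moments.) -/
def IsXiLaw (α : ℝ) (ν : ProbabilityMeasure ℝ) : Prop :=
  ∀ t : ℝ, mgf id (ν : Measure ℝ) t = Real.exp (phi α t)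

end SegmentGluing

end

/-! The law of `D_n` is explicit. Write `A_n` for the total length of `T_n`, `p_n = a_n / A_n`, `S_n
= weightedSum a n`, and `m` for the moment generating function of a uniform variable on `[0, 1]`.
With probability `1 - p_(n+1)` a uniform point of `T_(n+1)` is a uniform point of `T_n`. Otherwise
it sits on the new segment, and its height is that of the gluing point, itself uniform on `T_n`,
plus an independent uniform variable on `[0, a_(n+1)]`. Hence `E[exp (t D_n)] = ∏_{i ≤ n} (1 + p_i
(m(t a_i) - 1))` (`lintegral_exp_height`). So `D_n` has the law of a sum of independent variables,
and only the limit of this product at `t / S_n` is needed.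

Regular variation gives `n p_n → α + 1` (Karamata). If `α > 0`, moreover `a_n / S_n → α`, so the
logarithm of the product is a Riemann sum for `∫_0^1 (α + 1) u⁻¹ (m(α t u^α) - 1) du = φ_α(α t)`,
dominated thanks to Potter's bound. If `α = 0` and `S_n → ∞`, then `max_{i ≤ n} a_i = o(S_n)` and `∑
p_i a_i ~ S_n`, so a second order expansion of the logarithm leaves only the mean `t / 2`. If `α =
0` and `S_n` converges, the series of logarithms converges by domination.

Pointwise convergence of moment generating functions on all of `ℝ` implies weak convergence
(`exists_tendsto_of_tendsto_mgf`). This also produces the limit laws, including that of `ξ_(α)`. -/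

namespace SegmentGluing

/-! ### Convergence of moment generating functions -/

/-- A law on `ℝ` with exponential moments of all orders is determined by its moment generating
function. -/
lemma measure_eq_of_mgf_eq {μ ν : Measure ℝ} [IsProbabilityMeasure μ] [IsProbabilityMeasure ν]
    (hμ : ∀ t, Integrable (fun x : ℝ => Real.exp (t * x)) μ)
    (h : ∀ t, mgf id μ t = mgf id ν t) : μ = ν := by
  have huniv : integrableExpSet id μ = Set.univ := by
    ext t
    simpa [integrableExpSet] using hμ t
  refine Measure.ext_of_complexMGF_id_eq ?_
  ext z
  exact eqOn_complexMGF_of_mgf (funext h) (by simp [huniv])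

/-- Fatou's lemma as `K → ∞`. The truncation is there because weak convergence only tests bounded
continuous functions. -/
lemma integrable_exp_of_truncation_le {μ : Measure ℝ} [IsProbabilityMeasure μ] {t M : ℝ}
    (h : ∀ K : ℕ, ∫ x, min (Real.exp (t * x)) K ∂μ ≤ M) :
    Integrable (fun x : ℝ => Real.exp (t * x)) μ ∧ mgf id μ t ≤ M := by
  have hM : 0 ≤ M := by
    refine le_trans (integral_nonneg fun x => ?_) (h 0)
    simp [Real.exp_nonneg]
  have hbound : ∫⁻ x, ENNReal.ofReal (Real.exp (t * x)) ∂μ ≤ ENNReal.ofReal M := by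
    have htend : ∀ x : ℝ, Tendsto (fun K : ℕ => ENNReal.ofReal (min (Real.exp (t * x)) K)) atTop
        (𝓝 (ENNReal.ofReal (Real.exp (t * x)))) := by
      intro x
      refine tendsto_const_nhds.congr' ?_
      filter_upwards [tendsto_natCast_atTop_atTop.eventually_ge_atTop (Real.exp (t * x))] with K hK
      rw [min_eq_left hK]
    calc ∫⁻ x, ENNReal.ofReal (Real.exp (t * x)) ∂μ
        = ∫⁻ x, liminf (fun K : ℕ => ENNReal.ofReal (min (Real.exp (t * x)) K)) atTop ∂μ := by
          refine lintegral_congr fun x => ?_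
          rw [(htend x).liminf_eq]
      _ ≤ liminf (fun K : ℕ => ∫⁻ x, ENNReal.ofReal (min (Real.exp (t * x)) K) ∂μ) atTop :=
          lintegral_liminf_le fun K => by fun_prop
      _ ≤ liminf (fun _ : ℕ => ENNReal.ofReal M) atTop := by
          refine liminf_le_liminf (Eventually.of_forall fun K => ?_)
          have hint : Integrable (fun x : ℝ => min (Real.exp (t * x)) (K : ℝ)) μ := by
            refine Integrable.of_bound (by fun_prop) K (ae_of_all _ fun x => ?_)
            rw [Real.norm_eq_abs, abs_of_nonneg (le_min (Real.exp_nonneg _) (Nat.cast_nonneg _))]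
            exact min_le_right _ _
          rw [← ofReal_integral_eq_lintegral_ofReal hint
            (ae_of_all _ fun x => le_min (Real.exp_nonneg _) (Nat.cast_nonneg _))]
          exact ENNReal.ofReal_le_ofReal (h K)
      _ = ENNReal.ofReal M := by simp
  have hint : Integrable (fun x : ℝ => Real.exp (t * x)) μ := by
    refine ⟨by fun_prop, ?_⟩
    rw [hasFiniteIntegral_iff_ofReal (ae_of_all _ fun x => Real.exp_nonneg _)]
    exact hbound.trans_lt ENNReal.ofReal_lt_top
  refine ⟨hint, ?_⟩
  rw [← ofReal_integral_eq_lintegral_ofReal hint (ae_of_all _ fun x => Real.exp_nonneg _)] at hbound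
  simpa [mgf] using (ENNReal.ofReal_le_ofReal_iff hM).1 hbound

/-- Uniform integrability: weak convergence handles the truncated exponentials, and the convergent
generating function at `2 * t` controls the truncation error by `O(1 / K)`. A general filter is
allowed so that the lemma applies along ultrafilters. -/
lemma mgf_eq_of_tendsto {ι : Type*} {l : Filter ι} [l.NeBot] {μ : ι → ProbabilityMeasure ℝ}
    {ν : ProbabilityMeasure ℝ} {M : ℝ → ℝ}
    (hint : ∀ i t, Integrable (fun x : ℝ => Real.exp (t * x)) (μ i : Measure ℝ))
    (hM : ∀ t, Tendsto (fun i => mgf id (μ i : Measure ℝ) t) l (𝓝 (M t)))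
    (hν : Tendsto μ l (𝓝 ν)) (t : ℝ) :
    Integrable (fun x : ℝ => Real.exp (t * x)) (ν : Measure ℝ) ∧
      mgf id (ν : Measure ℝ) t = M t := by
  have htrunc_int : ∀ (ρ : ProbabilityMeasure ℝ) (K : ℕ),
      Integrable (fun x : ℝ => min (Real.exp (t * x)) (K : ℝ)) (ρ : Measure ℝ) := by
    intro ρ K
    refine Integrable.of_bound (by fun_prop) K (ae_of_all _ fun x => ?_)
    rw [Real.norm_eq_abs, abs_of_nonneg (le_min (Real.exp_nonneg _) (Nat.cast_nonneg _))]
    exact min_le_right _ _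
  have htrunc : ∀ K : ℕ, Tendsto (fun i => ∫ x, min (Real.exp (t * x)) (K : ℝ) ∂(μ i : Measure ℝ)) l
      (𝓝 (∫ x, min (Real.exp (t * x)) (K : ℝ) ∂(ν : Measure ℝ))) := by
    intro K
    have hc : Continuous fun x : ℝ => min (Real.exp (t * x)) (K : ℝ) := by fun_prop
    exact (ProbabilityMeasure.tendsto_iff_forall_integral_tendsto.1 hν)
      (BoundedContinuousFunction.ofNormedAddCommGroup _ hc K fun x => by
        rw [Real.norm_eq_abs, abs_of_nonneg (le_min (Real.exp_nonneg _) (Nat.cast_nonneg _))]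
        exact min_le_right _ _)
  obtain ⟨hi, hle⟩ := integrable_exp_of_truncation_le (μ := (ν : Measure ℝ)) (t := t) (M := M t)
    fun K => le_of_tendsto_of_tendsto' (htrunc K) (hM t) fun i => by
      simp only [mgf, id]
      exact integral_mono (htrunc_int _ K) (hint i t) fun x => min_le_left _ _
  refine ⟨hi, le_antisymm hle ?_⟩
  -- With `y = exp (t x)`, this is the pointwise bound `y - y² / K ≤ min y K`, integrated and passed
  -- to the limit.
  have hlow : ∀ K : ℕ, 0 < K → M t - M (2 * t) / K ≤ mgf id (ν : Measure ℝ) t := by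
    intro K hK
    have hK' : (0 : ℝ) < K := by exact_mod_cast hK
    have h1 : M t - M (2 * t) / K ≤ ∫ x, min (Real.exp (t * x)) (K : ℝ) ∂(ν : Measure ℝ) := by
      refine le_of_tendsto_of_tendsto' ((hM t).sub ((hM (2 * t)).div_const K)) (htrunc K) fun i => ?_
      simp only [mgf, id]
      rw [← integral_div, ← integral_sub (hint i t) ((hint i _).div_const _)]
      refine integral_mono ((hint i t).sub ((hint i _).div_const _)) (htrunc_int _ K) fun x => ?_
      have hx : Real.exp (2 * t * x) = Real.exp (t * x) * Real.exp (t * x) := by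
        rw [← Real.exp_add]; ring_nf
      have hp := Real.exp_pos (t * x)
      simp only [hx]
      rcases le_total (Real.exp (t * x)) K with h | h
      · rw [min_eq_left h]
        have : 0 ≤ Real.exp (t * x) * Real.exp (t * x) / K := by positivity
        linarith
      · rw [min_eq_right h]
        have : Real.exp (t * x) ≤ Real.exp (t * x) * Real.exp (t * x) / K := by
          rw [le_div_iff₀ hK']
          gcongr
        linarith
    refine h1.trans ?_
    simp only [mgf, id]
    exact integral_mono (htrunc_int _ K) hi fun x => min_le_left _ _
  have hlim : Tendsto (fun K : ℕ => M t - M (2 * t) / (K : ℝ)) atTop (𝓝 (M t - 0)) :=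
    tendsto_const_nhds.sub (tendsto_const_div_atTop_nhds_zero_nat _)
  rw [sub_zero] at hlim
  refine le_of_tendsto hlim ?_
  filter_upwards [eventually_gt_atTop 0] with K hK using hlow K hK

/-- Chernoff's bound at `t = 1` and `t = -1` makes both tails at most of order `exp (-r)`, uniformly
over `S`. -/
lemma isTightMeasureSet_of_mgf_le {S : Set (Measure ℝ)} {C : ℝ}
    (hprob : ∀ μ ∈ S, IsProbabilityMeasure μ)
    (hint : ∀ μ ∈ S, ∀ t, Integrable (fun x : ℝ => Real.exp (t * x)) μ)
    (hC : ∀ μ ∈ S, mgf id μ 1 + mgf id μ (-1) ≤ C) : IsTightMeasureSet S := by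
  rw [isTightMeasureSet_iff_exists_isCompact_measure_compl_le]
  intro ε hε
  have hlim : Tendsto (fun r : ℝ => ENNReal.ofReal (Real.exp (-r) * C)) atTop (𝓝 0) := by
    have : Tendsto (fun r : ℝ => Real.exp (-r) * C) atTop (𝓝 (0 * C)) :=
      (Real.tendsto_exp_neg_atTop_nhds_zero).mul_const C
    rw [zero_mul] at this
    simpa using ENNReal.tendsto_ofReal this
  obtain ⟨r, hr0, hr⟩ := ((eventually_ge_atTop (0 : ℝ)).and (hlim.eventually_le_const hε)).exists
  refine ⟨Set.Icc (-r) r, isCompact_Icc, fun μ hμ => ?_⟩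
  have := hprob μ hμ
  refine le_trans ?_ hr
  rw [← ofReal_measureReal]
  refine ENNReal.ofReal_le_ofReal ?_
  have hsub : (Set.Icc (-r) r)ᶜ ⊆ {x : ℝ | r ≤ id x} ∪ {x : ℝ | id x ≤ -r} := by
    intro x hx
    simp only [Set.mem_compl_iff, Set.mem_Icc, not_and_or, not_le] at hx
    rcases hx with h | h
    · exact Or.inr h.le
    · exact Or.inl h.le
  have h1 := measure_ge_le_exp_mul_mgf (μ := μ) (X := id) r (t := 1) zero_le_one (hint μ hμ 1)
  have h2 := measure_le_le_exp_mul_mgf (μ := μ) (X := id) (-r) (t := -1) (by norm_num) (hint μ hμ (-1))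
  calc μ.real (Set.Icc (-r) r)ᶜ ≤ μ.real ({x : ℝ | r ≤ id x} ∪ {x : ℝ | id x ≤ -r}) :=
        measureReal_mono hsub
    _ ≤ μ.real {x : ℝ | r ≤ id x} + μ.real {x : ℝ | id x ≤ -r} := measureReal_union_le _ _
    _ ≤ Real.exp (-r) * mgf id μ 1 + Real.exp (-r) * mgf id μ (-1) := by
        refine add_le_add (by simpa using h1) (by simpa using h2)
    _ ≤ Real.exp (-r) * C := by
        rw [← mul_add]
        exact mul_le_mul_of_nonneg_left (hC μ hμ) (Real.exp_nonneg _)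

/-- If the moment generating functions of a sequence of laws on `ℝ` converge pointwise on `ℝ`, then
these laws converge weakly, and the limit of the moment generating functions is that of the
limit law. -/
theorem exists_tendsto_of_tendsto_mgf {μ : ℕ → ProbabilityMeasure ℝ} {M : ℝ → ℝ}
    (hint : ∀ n t, Integrable (fun x : ℝ => Real.exp (t * x)) (μ n : Measure ℝ))
    (hM : ∀ t, Tendsto (fun n => mgf id (μ n : Measure ℝ) t) atTop (𝓝 (M t))) :
    ∃ ν : ProbabilityMeasure ℝ, Tendsto μ atTop (𝓝 ν) ∧
      ∀ t, Integrable (fun x : ℝ => Real.exp (t * x)) (ν : Measure ℝ) ∧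
        mgf id (ν : Measure ℝ) t = M t := by
  obtain ⟨C, hC⟩ := ((hM 1).add (hM (-1))).bddAbove_range
  have hcompact : IsCompact (closure (Set.range μ)) := by
    refine isCompact_closure_of_isTightMeasureSet (isTightMeasureSet_of_mgf_le (C := C) ?_ ?_ ?_)
    · rintro _ ⟨ρ, -, rfl⟩
      infer_instance
    · rintro _ ⟨_, ⟨n, rfl⟩, rfl⟩ t
      exact hint n t
    · rintro _ ⟨_, ⟨n, rfl⟩, rfl⟩
      exact hC ⟨n, rfl⟩
  have hmem : ∀ n, μ n ∈ closure (Set.range μ) := fun n => subset_closure ⟨n, rfl⟩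
  -- By Prokhorov the sequence is relatively compact. All its cluster points have generating
  -- function `M`, so they coincide and the sequence converges.
  have hclus : ∀ ν, MapClusterPt ν atTop μ →
      ∀ t, Integrable (fun x : ℝ => Real.exp (t * x)) (ν : Measure ℝ) ∧
        mgf id (ν : Measure ℝ) t = M t := by
    intro ν hν
    obtain ⟨U, hU, hUν⟩ := mapClusterPt_iff_ultrafilter.1 hν
    exact mgf_eq_of_tendsto hint (fun t => (hM t).mono_left hU) hUν
  obtain ⟨ν, -, hν⟩ := hcompact.exists_mapClusterPt
    (tendsto_principal.2 (Eventually.of_forall hmem) : Tendsto μ atTop _)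
  refine ⟨ν, ?_, hclus ν hν⟩
  refine hcompact.tendsto_nhds_of_unique_mapClusterPt (Eventually.of_forall hmem) ?_
  intro ρ _ hρ
  have heq : (ρ : Measure ℝ) = (ν : Measure ℝ) :=
    measure_eq_of_mgf_eq (fun t => (hclus ρ hρ t).1) fun t =>
      (hclus ρ hρ t).2.trans (hclus ν hν t).2.symm
  exact Subtype.ext heq

/-! ### Regularly varying sequences -/

lemma tendsto_floor_mul_atTop {c : ℝ} (hc : 0 < c) :
    Tendsto (fun n : ℕ => ⌊c * n⌋₊) atTop atTop :=
  tendsto_nat_floor_atTop.comp (tendsto_natCast_atTop_atTop.const_mul_atTop hc)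

lemma tendsto_floor_mul_div {c : ℝ} (hc : 0 < c) :
    Tendsto (fun n : ℕ => (⌊c * n⌋₊ : ℝ) / n) atTop (𝓝 c) :=
  (tendsto_nat_floor_mul_div_atTop hc.le).comp tendsto_natCast_atTop_atTop

/-- For irrational `c > 1`, rounding `c (n + 1)` down and then dividing by `c` and rounding down
lands exactly on `n`: the first rounding is strict and loses less than `1`. Regular variation at `c`
and at `c⁻¹` thus compares `a (n + 1)` with `a n`, and the two limits are inverse to each other. -/
lemma RegularlyVarying.tendsto_succ_div {a : ℕ → ℝ} {α : ℝ} (ha : ∀ n, 1 ≤ n → 0 < a n)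
    (h : RegularlyVarying a α) : Tendsto (fun n => a (n + 1) / a n) atTop (𝓝 1) := by
  set c : ℝ := √2
  have hirr : Irrational c := irrational_sqrt_two
  have hc : 1 < c := by
    rw [← Real.sqrt_one]
    exact Real.sqrt_lt_sqrt zero_le_one (by norm_num)
  have hc0 : 0 < c := zero_lt_one.trans hc
  have hfloor : ∀ n : ℕ, ⌊c⁻¹ * (⌊c * ((n + 1 : ℕ) : ℝ)⌋₊ : ℝ)⌋₊ = n := by
    intro n
    set m := ⌊c * ((n + 1 : ℕ) : ℝ)⌋₊
    have hm1 : (m : ℝ) ≤ c * ((n + 1 : ℕ) : ℝ) := Nat.floor_le (by positivity)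
    have hm2 : c * ((n + 1 : ℕ) : ℝ) < m + 1 := Nat.lt_floor_add_one _
    have hne : (m : ℝ) ≠ c * ((n + 1 : ℕ) : ℝ) := ((hirr.mul_natCast (by simp)).ne_nat m).symm
    have hm3 := lt_of_le_of_ne hm1 hne
    push_cast at hm2 hm3
    rw [Nat.floor_eq_iff (by positivity)]
    constructor
    · rw [inv_mul_eq_div, le_div_iff₀ hc0]
      nlinarith
    · rw [inv_mul_eq_div, div_lt_iff₀ hc0]
      nlinarith
  have hsucc : Tendsto (fun n : ℕ => n + 1) atTop atTop := tendsto_add_atTop_nat 1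
  have h1 := (h c hc0).comp hsucc
  have h2 := ((h c⁻¹ (inv_pos.2 hc0)).comp (tendsto_floor_mul_atTop hc0)).comp hsucc
  have h3 := (h1.mul h2).inv₀ (by positivity)
  rw [Real.inv_rpow hc0.le, mul_inv_cancel₀ (by positivity), inv_one] at h3
  refine h3.congr' ?_
  filter_upwards [eventually_ge_atTop 1] with n hn
  have hm : 1 ≤ ⌊c * ((n + 1 : ℕ) : ℝ)⌋₊ := by
    rw [Nat.one_le_floor_iff]
    push_cast
    nlinarith [(Nat.cast_nonneg n : (0 : ℝ) ≤ n)]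
  have := ha _ hm
  have := ha n hn
  have := ha (n + 1) (by omega)
  simp only [Function.comp, hfloor]
  field_simp

/-- The index `⌊c n⌋ + 1` is the one appearing when a sum over `{1, …, n}` is written as the
integral of a step function. -/
lemma RegularlyVarying.tendsto_floor_succ {a : ℕ → ℝ} {α : ℝ} (ha : ∀ n, 1 ≤ n → 0 < a n)
    (h : RegularlyVarying a α) {c : ℝ} (hc : 0 < c) :
    Tendsto (fun n : ℕ => a (⌊c * n⌋₊ + 1) / a n) atTop (𝓝 (c ^ α)) := by
  have h1 := ((h.tendsto_succ_div ha).comp (tendsto_floor_mul_atTop hc)).mul (h c hc)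
  rw [one_mul] at h1
  refine h1.congr' ?_
  filter_upwards [(tendsto_floor_mul_atTop hc).eventually_ge_atTop 1] with n hn
  have := ha _ hn
  simp only [Function.comp]
  field_simp

lemma RegularlyVarying.mul_rpow {a : ℕ → ℝ} {α : ℝ} (h : RegularlyVarying a α) (ρ : ℝ) :
    RegularlyVarying (fun n => a n * (n : ℝ) ^ ρ) (α + ρ) := by
  intro c hc
  have h1 := (h c hc).mul ((tendsto_floor_mul_div hc).rpow_const (p := ρ) (Or.inl hc.ne'))
  rw [← Real.rpow_add hc] at h1
  refine h1.congr fun n => ?_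
  rw [Real.div_rpow (by positivity) (by positivity)]
  ring

lemma measurable_apply_floor_mul (b : ℕ → ℝ) (n : ℕ) :
    Measurable fun v : ℝ => b ⌊v * n⌋₊ :=
  (measurable_from_nat (f := b)).comp (Nat.measurable_floor.comp (measurable_id.mul_const _))

/-- The sets `{v ∈ [p, q] : ∀ n ≥ N, u n v}` exhaust `[p, q]` if `u n v` holds eventually for every
`v ∈ [p, q]`, so that their measures come arbitrarily close to `q - p`. -/
lemma exists_lt_volume_forall_ge {u : ℕ → ℝ → Prop} {p q : ℝ}
    (hev : ∀ v ∈ Set.Icc p q, ∀ᶠ n in atTop, u n v) {r : ENNReal}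
    (hr : r < ENNReal.ofReal (q - p)) :
    ∃ N₀, ∀ N ≥ N₀, r < volume {v | v ∈ Set.Icc p q ∧ ∀ n ≥ N, u n v} := by
  have hmono : Monotone fun N => {v | v ∈ Set.Icc p q ∧ ∀ n ≥ N, u n v} :=
    fun N N' hN v hv => ⟨hv.1, fun n hn => hv.2 n (hN.trans hn)⟩
  have hunion : ⋃ N, {v | v ∈ Set.Icc p q ∧ ∀ n ≥ N, u n v} = Set.Icc p q := by
    ext v
    simp only [Set.mem_iUnion, Set.mem_ofPred_eq, exists_and_left, and_iff_left_iff_imp]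
    exact fun hv => eventually_atTop.1 (hev v hv)
  have ht := tendsto_measure_iUnion_atTop (μ := volume) hmono
  rw [hunion, Real.volume_Icc] at ht
  exact eventually_atTop.1 (ht.eventually_const_lt hr)

/-- The values of a regularly varying sequence on `[n / 2, n]` are at most of the order of its
value at `n`. -/
lemma RegularlyVarying.exists_le_mul_of_half_le {b : ℕ → ℝ} {β : ℝ}
    (hb : ∀ n, 1 ≤ n → 0 < b n) (h : RegularlyVarying b β) :
    ∃ C N, 0 < C ∧ ∀ n i : ℕ, N ≤ i → i ≤ n → n ≤ 2 * i → b i ≤ C * b n := by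
  obtain ⟨C₁, hC₁⟩ : ∃ C₁ : ℝ, ∀ v ∈ Set.Icc (2 : ℝ) 3, v ^ β < C₁ := by
    have hcont : ContinuousOn (fun v : ℝ => v ^ β) (Set.Icc 2 3) := fun v hv =>
      (Real.continuousAt_rpow_const v β (Or.inl (by linarith [hv.1]))).continuousWithinAt
    obtain ⟨C, hC⟩ := isCompact_Icc.bddAbove_image hcont
    exact ⟨C + 1, fun v hv => (hC ⟨v, hv, rfl⟩).trans_lt (lt_add_one C)⟩
  obtain ⟨c₁, hc₁0, hc₁⟩ : ∃ c₁ : ℝ, 0 < c₁ ∧ ∀ v ∈ Set.Icc (2 : ℝ) 6, c₁ < v ^ β := by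
    have hcont : ContinuousOn (fun v : ℝ => v ^ β) (Set.Icc 2 6) := fun v hv =>
      (Real.continuousAt_rpow_const v β (Or.inl (by linarith [hv.1]))).continuousWithinAt
    obtain ⟨w, hw, hmin⟩ := isCompact_Icc.exists_isMinOn ⟨2, by norm_num⟩ hcont
    have hpos : 0 < w ^ β := Real.rpow_pos_of_pos (by linarith [hw.1]) β
    exact ⟨w ^ β / 2, by positivity, fun v hv => (half_lt_self hpos).trans_le (hmin hv)⟩
  have hC₁0 : 0 < C₁ := (Real.rpow_pos_of_pos two_pos β).trans (hC₁ 2 (by norm_num))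
  have hVev : ∀ v ∈ Set.Icc (2 : ℝ) 3, ∀ᶠ n in atTop, b ⌊v * (n : ℕ)⌋₊ ≤ C₁ * b n := by
    intro v hv
    filter_upwards [(h v (by linarith [hv.1])).eventually_lt_const (hC₁ v hv),
      eventually_ge_atTop 1] with n hn h1
    exact ((div_lt_iff₀ (hb n h1)).1 hn).le
  have hWev : ∀ v ∈ Set.Icc (2 : ℝ) 6, ∀ᶠ n in atTop, c₁ * b n ≤ b ⌊v * (n : ℕ)⌋₊ := by
    intro v hv
    filter_upwards [(h v (by linarith [hv.1])).eventually_const_lt (hc₁ v hv),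
      eventually_ge_atTop 1] with n hn h1
    exact ((lt_div_iff₀ (hb n h1)).1 hn).le
  -- The thresholds `1/2` and `7/2` add up to `4`, the length of `[2, 6]`. This interval contains
  -- `W` and every dilation of `V ⊆ [2, 3]` by a factor `r ∈ [1, 2]`, so the dilated set and `W`
  -- must meet.
  obtain ⟨N₁, hN₁⟩ := exists_lt_volume_forall_ge hVev (r := ENNReal.ofReal (1 / 2))
    ((ENNReal.ofReal_lt_ofReal_iff (by norm_num)).2 (by norm_num))
  obtain ⟨N₂, hN₂⟩ := exists_lt_volume_forall_ge hWev (r := ENNReal.ofReal (7 / 2))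
    ((ENNReal.ofReal_lt_ofReal_iff (by norm_num)).2 (by norm_num))
  refine ⟨C₁ / c₁, max (max N₁ N₂) 1, by positivity, fun n i hi hin hni => ?_⟩
  set N := max (max N₁ N₂) 1
  have hi0 : (0 : ℝ) < i := by
    have : 1 ≤ i := (le_max_right _ _).trans hi
    exact_mod_cast this
  have hin' : (i : ℝ) ≤ n := by exact_mod_cast hin
  have hni' : (n : ℝ) ≤ 2 * i := by exact_mod_cast hni
  set V : Set ℝ := {v | v ∈ Set.Icc (2 : ℝ) 3 ∧ ∀ n ≥ N, b ⌊v * (n : ℕ)⌋₊ ≤ C₁ * b n}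
  set W : Set ℝ := {v | v ∈ Set.Icc (2 : ℝ) 6 ∧ ∀ n ≥ N, c₁ * b n ≤ b ⌊v * (n : ℕ)⌋₊}
  have hV : ENNReal.ofReal (1 / 2) < volume V :=
    hN₁ N ((le_max_left _ _).trans (le_max_left _ _))
  have hW : ENNReal.ofReal (7 / 2) < volume W :=
    hN₂ N ((le_max_right _ _).trans (le_max_left _ _))
  have hWm : MeasurableSet W := by
    have hWeq : W = Set.Icc (2 : ℝ) 6 ∩ ⋂ (n : ℕ) (_ : N ≤ n), {v | c₁ * b n ≤ b ⌊v * n⌋₊} := by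
      ext v
      simp [W]
    rw [hWeq]
    exact measurableSet_Icc.inter (MeasurableSet.iInter fun n => MeasurableSet.iInter fun _ =>
      measurableSet_le measurable_const (measurable_apply_floor_mul b n))
  set r : ℝ := n / i with hr
  have hr1 : 1 ≤ r := (one_le_div hi0).2 hin'
  have hr2 : r ≤ 2 := (div_le_iff₀ hi0).2 hni'
  set V' : Set ℝ := (fun w => r⁻¹ * w) ⁻¹' V
  have hV' : volume V ≤ volume V' := by
    have : volume V' = ENNReal.ofReal r * volume V := by
      rw [Real.volume_preimage_mul_left (by positivity), inv_inv, abs_of_pos (by positivity)]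
    rw [this]
    exact le_mul_of_one_le_left zero_le (by simpa using hr1)
  have hsub : V' ∪ W ⊆ Set.Icc 2 6 := by
    rintro w (hw | hw)
    · have h1 := hw.1.1
      have h2 := hw.1.2
      simp only [inv_mul_eq_div] at h1 h2
      rw [le_div_iff₀ (by positivity)] at h1
      rw [div_le_iff₀ (by positivity)] at h2
      constructor <;> nlinarith
    · exact hw.1
  have hnd : ¬ Disjoint V' W := by
    intro hd
    have h1 : volume (V' ∪ W) = volume V' + volume W := measure_union hd hWm
    have h2 : volume (V' ∪ W) ≤ ENNReal.ofReal 4 := by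
      refine (measure_mono hsub).trans ?_
      rw [Real.volume_Icc]
      exact ENNReal.ofReal_le_ofReal (by norm_num)
    have h3 : ENNReal.ofReal (1 / 2) + ENNReal.ofReal (7 / 2) < volume V' + volume W :=
      ENNReal.add_lt_add (hV.trans_le hV') hW
    rw [← ENNReal.ofReal_add (by norm_num) (by norm_num)] at h3
    norm_num at h3
    rw [← h1] at h3
    exact absurd (h3.trans_le h2) (by norm_num)
  -- Since `r = n / i`, the points `(w / r) n` and `w i` agree. The single value `b ⌊w i⌋` is thus
  -- bounded above through `b n` and below through `b i`.
  obtain ⟨w, hwV, hwW⟩ := Set.not_disjoint_iff.1 hnd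
  have h1 : b ⌊r⁻¹ * w * (n : ℕ)⌋₊ ≤ C₁ * b n := hwV.2 n (hi.trans hin)
  have h2 : c₁ * b i ≤ b ⌊w * (i : ℕ)⌋₊ := hwW.2 i hi
  have h3 : r⁻¹ * w * (n : ℝ) = w * i := by
    have : (0 : ℝ) < n := hi0.trans_le hin'
    rw [hr]
    field_simp
  rw [h3] at h1
  rw [div_mul_eq_mul_div, le_div_iff₀ hc₁0]
  linarith

/-- A regularly varying sequence of positive index is increasing up to a multiplicative
constant. -/
lemma RegularlyVarying.exists_le_mul {b : ℕ → ℝ} {β : ℝ} (hβ : 0 < β)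
    (hb : ∀ n, 1 ≤ n → 0 < b n) (h : RegularlyVarying b β) :
    ∃ C, 0 < C ∧ ∀ n i : ℕ, 1 ≤ i → i ≤ n → b i ≤ C * b n := by
  obtain ⟨C, N₁, hC, hloc⟩ := h.exists_le_mul_of_half_le hb
  -- As `β > 0`, the limit `2^(-β)` of the ratio is below `1`. Halving `n` therefore costs no
  -- constant, and the constant `C` of the local bound survives the induction.
  have hhalf : ∀ᶠ n : ℕ in atTop, b (n / 2) ≤ b n := by
    have hlt : (2⁻¹ : ℝ) ^ β < 1 := Real.rpow_lt_one (by norm_num) (by norm_num) hβ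
    filter_upwards [(h 2⁻¹ (by norm_num)).eventually_lt_const hlt, eventually_ge_atTop 1]
      with n hn h1
    have : ⌊(2⁻¹ : ℝ) * n⌋₊ = n / 2 := by
      rw [inv_mul_eq_div]
      exact_mod_cast Nat.floor_div_natCast (n : ℝ) 2 |>.trans (by simp)
    rw [this] at hn
    exact ((div_lt_one (hb n h1)).1 hn).le
  obtain ⟨N₂, hN₂⟩ := eventually_atTop.1 hhalf
  set N := max (max N₁ N₂) 1
  have hlarge : ∀ n i : ℕ, N ≤ i → i ≤ n → b i ≤ C * b n := by
    intro n
    induction n using Nat.strong_induction_on with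
    | _ n ih =>
      intro i hNi hin
      have hi1 : 1 ≤ i := (le_max_right _ _).trans hNi
      by_cases hni : n ≤ 2 * i
      · exact hloc n i (((le_max_left _ _).trans (le_max_left _ _)).trans hNi) hin hni
      · refine (ih (n / 2) (by omega) i hNi (by omega)).trans ?_
        exact mul_le_mul_of_nonneg_left
          (hN₂ n ((((le_max_right _ _).trans (le_max_left _ _)).trans hNi).trans hin)) hC.le
  -- The remaining indices up to `N` give finitely many ratios.
  obtain ⟨K, hK⟩ : ∃ K : ℝ, ∀ i ∈ Finset.Icc 1 N, ∀ j ∈ Finset.Icc 1 N, b i ≤ K * b j := by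
    obtain ⟨K, hK⟩ := ((Finset.Icc 1 N ×ˢ Finset.Icc 1 N).image
      fun p : ℕ × ℕ => b p.1 / b p.2).bddAbove
    refine ⟨K, fun i hi j hj => ?_⟩
    rw [← div_le_iff₀ (hb j (Finset.mem_Icc.1 hj).1)]
    refine hK ?_
    simp only [Finset.coe_image, Set.mem_image, Finset.mem_coe, Finset.mem_product]
    exact ⟨(i, j), ⟨hi, hj⟩, rfl⟩
  have hN1 : 1 ≤ N := le_max_right _ _
  have hK1 : 1 ≤ K := by
    have := hK N (by simp [hN1]) N (by simp [hN1])
    have hbN := hb N hN1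
    nlinarith
  have hC1 : 1 ≤ C := by
    have := hlarge N N le_rfl le_rfl
    have hbN := hb N hN1
    nlinarith
  refine ⟨K * C, by positivity, fun n i hi hin => ?_⟩
  have hbn := hb n (hi.trans hin)
  have hCb : 0 < C * b n := by positivity
  rcases le_total N i with hNi | hiN
  · nlinarith [hlarge n i hNi hin]
  · rcases le_total N n with hNn | hnN
    · have h1 := hK i (by simp [hi, hiN]) N (by simp [hN1])
      have h2 := hlarge n N le_rfl hNn
      nlinarith
    · have h1 := hK i (by simp [hi, hiN]) n (by simp [hnN, hi.trans hin])
      have hKb : 0 < K * b n := by positivity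
      nlinarith

/-- Potter's bound. -/
lemma RegularlyVarying.exists_div_le_rpow {a : ℕ → ℝ} {α ρ : ℝ} (hρ : ρ < α)
    (ha : ∀ n, 1 ≤ n → 0 < a n) (h : RegularlyVarying a α) :
    ∃ C, 0 < C ∧ ∀ n i : ℕ, 1 ≤ i → i ≤ n → a i / a n ≤ C * ((i : ℝ) / n) ^ ρ := by
  have hpos : ∀ n : ℕ, 1 ≤ n → (0 : ℝ) < n := fun n hn => by exact_mod_cast hn
  -- The sequence `a n * n ^ (-ρ)` has positive index `α - ρ`, so it is increasing up to a constant.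
  obtain ⟨C, hC, hle⟩ := (h.mul_rpow (-ρ)).exists_le_mul (by linarith)
    (fun n hn => mul_pos (ha n hn) (Real.rpow_pos_of_pos (hpos n hn) _))
  refine ⟨C, hC, fun n i hi hin => ?_⟩
  have hn := hi.trans hin
  have h1 := hle n i hi hin
  have hi' := Real.rpow_pos_of_pos (hpos i hi) ρ
  have hn' := Real.rpow_pos_of_pos (hpos n hn) ρ
  simp only [Real.rpow_neg (hpos i hi).le, Real.rpow_neg (hpos n hn).le, ← div_eq_mul_inv] at h1
  rw [Real.div_rpow (hpos i hi).le (hpos n hn).le, div_le_iff₀ (ha n hn)]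
  rw [div_le_iff₀ hi'] at h1
  refine h1.trans (le_of_eq ?_)
  ring

/-! ### Limits of Riemann sums, and Karamata's theorem -/

/-- A mean over `{1, …, n}` is the integral of a step function. -/
lemma sum_div_eq_integral (x : ℕ → ℝ) {n : ℕ} (hn : 0 < n) :
    (∑ i ∈ Finset.Icc 1 n, x i) / n = ∫ u in (0 : ℝ)..1, x (⌊u * n⌋₊ + 1) := by
  have hn' : (0 : ℝ) < n := by exact_mod_cast hn
  have hpiece : ∀ k : ℕ, IntervalIntegrable (fun v : ℝ => x (⌊v⌋₊ + 1)) volume k (k + 1 : ℕ) ∧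
      ∫ v in (k : ℝ)..(k + 1 : ℕ), x (⌊v⌋₊ + 1) = x (k + 1) := by
    intro k
    have hle : (k : ℝ) ≤ (k + 1 : ℕ) := by exact_mod_cast k.le_succ
    have hae : ∀ᵐ v : ℝ, v ∈ Set.uIoc (k : ℝ) (k + 1 : ℕ) → x (k + 1) = x (⌊v⌋₊ + 1) := by
      have hne : ∀ᵐ v : ℝ, v ≠ (k + 1 : ℕ) := by simp [ae_iff, measure_singleton]
      filter_upwards [hne] with v hv hmem
      rw [Set.uIoc_of_le hle] at hmem
      have : ⌊v⌋₊ = k := by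
        rw [Nat.floor_eq_iff ((Nat.cast_nonneg k).trans hmem.1.le)]
        refine ⟨hmem.1.le, ?_⟩
        have := lt_of_le_of_ne hmem.2 hv
        exact_mod_cast this
      rw [this]
    constructor
    · refine (intervalIntegrable_const (c := x (k + 1))).congr_ae ?_
      rw [Filter.EventuallyEq, ae_restrict_iff' measurableSet_uIoc]
      exact hae
    · rw [← intervalIntegral.integral_congr_ae hae]
      simp
  have hsum := intervalIntegral.sum_integral_adjacent_intervals (n := n) (a := fun k : ℕ => (k : ℝ))
    (f := fun v : ℝ => x (⌊v⌋₊ + 1)) (μ := volume) fun k _ => (hpiece k).1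
  rw [Finset.sum_congr rfl fun k _ => (hpiece k).2] at hsum
  have hcomp := intervalIntegral.integral_comp_mul_right (a := 0) (b := 1)
    (fun v : ℝ => x (⌊v⌋₊ + 1)) hn'.ne'
  rw [hcomp, zero_mul, one_mul, smul_eq_mul]
  rw [Nat.cast_zero] at hsum
  rw [← hsum, Finset.range_eq_Ico, Finset.sum_Ico_add' x 0 n 1, inv_mul_eq_div]
  rfl

lemma intervalIntegrable_rpow_sub_one {γ : ℝ} (hγ : 0 < γ) :
    IntervalIntegrable (fun u : ℝ => u ^ (γ - 1)) volume 0 1 :=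
  intervalIntegral.intervalIntegrable_rpow' (by linarith)

/-- Convergence of Riemann sums by dominated convergence. -/
lemma tendsto_sum_div {x : ℕ → ℕ → ℝ} {L : ℝ → ℝ} {C γ : ℝ} (hγ : 0 < γ) (hγ1 : γ ≤ 1)
    (hbound : ∀ n i : ℕ, 1 ≤ i → i ≤ n → |x n i| ≤ C * ((i : ℝ) / n) ^ (γ - 1))
    (hlim : ∀ u : ℝ, 0 < u → u < 1 →
      Tendsto (fun n : ℕ => x n (⌊u * n⌋₊ + 1)) atTop (𝓝 (L u))) :
    Tendsto (fun n : ℕ => (∑ i ∈ Finset.Icc 1 n, x n i) / n) atTop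
      (𝓝 (∫ u in (0 : ℝ)..1, L u)) := by
  have hC : 0 ≤ C := by simpa using (abs_nonneg _).trans (hbound 1 1 le_rfl le_rfl)
  -- At `u = 1` the index `⌊u n⌋ + 1` equals `n + 1`, where `hbound` says nothing.
  have hne : ∀ᵐ u : ℝ, u ≠ 1 := by simp [ae_iff, measure_singleton]
  have hmain : Tendsto (fun n : ℕ => ∫ u in (0 : ℝ)..1, x n (⌊u * n⌋₊ + 1)) atTop
      (𝓝 (∫ u in (0 : ℝ)..1, L u)) := by
    refine intervalIntegral.tendsto_integral_filter_of_dominated_convergence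
      (fun u => C * u ^ (γ - 1)) ?_ ?_ ((intervalIntegrable_rpow_sub_one hγ).const_mul C) ?_
    · refine Eventually.of_forall fun n => Measurable.aestronglyMeasurable ?_
      exact measurable_apply_floor_mul (fun k => x n (k + 1)) n
    · filter_upwards [eventually_gt_atTop 0] with n hn
      filter_upwards [hne] with u hu1 hu
      rw [Set.uIoc_of_le zero_le_one] at hu
      have hn' : (0 : ℝ) < n := by exact_mod_cast hn
      have hu1' := lt_of_le_of_ne hu.2 hu1
      have hlt : ⌊u * n⌋₊ < n := by
        rw [Nat.floor_lt (by have := hu.1; positivity)]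
        nlinarith
      refine (hbound n _ (Nat.le_add_left 1 _) hlt).trans ?_
      refine mul_le_mul_of_nonneg_left ?_ hC
      -- The index exceeds `u n` and the exponent `γ - 1` is nonpositive, so the bound at the index
      -- is at most `u ^ (γ - 1)`.
      refine Real.rpow_le_rpow_of_nonpos hu.1 ?_ (by linarith)
      rw [le_div_iff₀ hn']
      have := Nat.lt_floor_add_one (u * n)
      push_cast
      exact this.le
    · filter_upwards [hne] with u hu1 hu
      rw [Set.uIoc_of_le zero_le_one] at hu
      exact hlim u hu.1 (lt_of_le_of_ne hu.2 hu1)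
  refine hmain.congr' ?_
  filter_upwards [eventually_gt_atTop 0] with n hn
  exact (sum_div_eq_integral (x n) hn).symm

/-- The total length of `T_n`. -/
noncomputable def totalLength (a : ℕ → ℝ) (n : ℕ) : ℝ := ∑ i ∈ Finset.Icc 1 n, a i

lemma totalLength_succ (a : ℕ → ℝ) (n : ℕ) :
    totalLength a (n + 1) = totalLength a n + a (n + 1) :=
  Finset.sum_Icc_succ_top (by omega) _

lemma totalLength_nonneg {a : ℕ → ℝ} (ha : ∀ n, 1 ≤ n → 0 < a n) (n : ℕ) :
    0 ≤ totalLength a n :=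
  Finset.sum_nonneg fun i hi => (ha i (Finset.mem_Icc.1 hi).1).le

lemma le_totalLength {a : ℕ → ℝ} (ha : ∀ n, 1 ≤ n → 0 < a n) {n : ℕ} (hn : 1 ≤ n) :
    a n ≤ totalLength a n :=
  Finset.single_le_sum (f := a) (fun i hi => (ha i (Finset.mem_Icc.1 hi).1).le)
    (Finset.mem_Icc.2 ⟨hn, le_rfl⟩)

lemma totalLength_pos {a : ℕ → ℝ} (ha : ∀ n, 1 ≤ n → 0 < a n) {n : ℕ} (hn : 1 ≤ n) :
    0 < totalLength a n :=
  (ha n hn).trans_le (le_totalLength ha hn)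

/-- The probability that a uniform point of `T_n` belongs to the last segment. -/
noncomputable def lastProb (a : ℕ → ℝ) (n : ℕ) : ℝ := a n / totalLength a n

lemma lastProb_nonneg {a : ℕ → ℝ} (ha : ∀ n, 1 ≤ n → 0 < a n) {n : ℕ} (hn : 1 ≤ n) :
    0 ≤ lastProb a n :=
  div_nonneg (ha n hn).le (totalLength_nonneg ha n)

lemma lastProb_le_one {a : ℕ → ℝ} (ha : ∀ n, 1 ≤ n → 0 < a n) {n : ℕ} (hn : 1 ≤ n) :
    lastProb a n ≤ 1 :=
  div_le_one_of_le₀ (le_totalLength ha hn) (totalLength_nonneg ha n)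

lemma lastProb_one {a : ℕ → ℝ} (ha : ∀ n, 1 ≤ n → 0 < a n) : lastProb a 1 = 1 := by
  simp [lastProb, totalLength, (ha 1 le_rfl).ne']

lemma weightedSum_mono {a : ℕ → ℝ} (ha : ∀ n, 1 ≤ n → 0 < a n) : Monotone (weightedSum a) := by
  intro m n hmn
  refine Finset.sum_le_sum_of_subset_of_nonneg (Finset.Icc_subset_Icc_right hmn) fun i hi _ => ?_
  have := ha i (Finset.mem_Icc.1 hi).1
  positivity

lemma weightedSum_pos {a : ℕ → ℝ} (ha : ∀ n, 1 ≤ n → 0 < a n) {n : ℕ} (hn : 1 ≤ n) :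
    0 < weightedSum a n := by
  have h1 : weightedSum a 1 = a 1 := by simp [weightedSum]
  exact (h1 ▸ ha 1 le_rfl : 0 < weightedSum a 1).trans_le (weightedSum_mono ha hn)

section

variable {a : ℕ → ℝ} {α : ℝ}

/-- Karamata: `A_n / (n a_n)` is a Riemann sum for `∫_0^1 u^α du = 1 / (α + 1)`. Potter's bound with
exponent `-1/2`, which is below every admissible `α`, provides the domination. -/
lemma RegularlyVarying.tendsto_mul_lastProb (hα : 0 ≤ α) (ha : ∀ n, 1 ≤ n → 0 < a n)
    (h : RegularlyVarying a α) :
    Tendsto (fun n : ℕ => n * lastProb a n) atTop (𝓝 (α + 1)) := by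
  obtain ⟨C, hC, hle⟩ := h.exists_div_le_rpow (ρ := -(1 / 2)) (by linarith) ha
  have hlim := tendsto_sum_div (x := fun n i => a i / a n) (L := fun u => u ^ α) (C := C)
    (γ := 1 / 2) (by norm_num) (by norm_num) (fun n i hi hin => by
      rw [abs_of_nonneg (div_nonneg (ha i hi).le (ha n (hi.trans hin)).le)]
      rw [show (1 / 2 - 1 : ℝ) = -(1 / 2) by norm_num]
      exact hle n i hi hin) (fun u hu _ => h.tendsto_floor_succ ha hu)
  have hint : ∫ u in (0 : ℝ)..1, u ^ α = (α + 1)⁻¹ := by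
    rw [integral_rpow (Or.inl (by linarith))]
    simp [Real.zero_rpow (by linarith : α + 1 ≠ 0)]
  rw [hint] at hlim
  have hinv := hlim.inv₀ (by positivity)
  rw [inv_inv] at hinv
  refine hinv.congr fun n => ?_
  rw [← Finset.sum_div, lastProb, totalLength, div_div, inv_div]
  ring

lemma RegularlyVarying.exists_lastProb_le (hα : 0 ≤ α) (ha : ∀ n, 1 ≤ n → 0 < a n)
    (h : RegularlyVarying a α) : ∃ C, 0 < C ∧ ∀ n, 1 ≤ n → lastProb a n ≤ C * (n : ℝ)⁻¹ := by
  obtain ⟨C, hC⟩ := (h.tendsto_mul_lastProb hα ha).bddAbove_range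
  refine ⟨max C 1, by positivity, fun n hn => ?_⟩
  have hn' : (0 : ℝ) < n := by exact_mod_cast hn
  rw [← div_eq_mul_inv, le_div_iff₀ hn', mul_comm]
  exact (hC ⟨n, rfl⟩).trans (le_max_left _ _)

/-- The ratio is a Riemann sum for `∫_0^1 u^(α - 1) du`. The Potter exponent `min (α / 2) 1` is
below `α`, positive so that the dominating function is integrable, and at most `1` as
`tendsto_sum_div` requires. -/
lemma RegularlyVarying.tendsto_weightedSum_div (hα : 0 < α) (ha : ∀ n, 1 ≤ n → 0 < a n)
    (h : RegularlyVarying a α) :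
    Tendsto (fun n : ℕ => weightedSum a n / a n) atTop (𝓝 α⁻¹) := by
  have hρ : min (α / 2) 1 < α := (min_le_left _ _).trans_lt (by linarith)
  have hρ0 : 0 < min (α / 2) 1 := lt_min (by linarith) one_pos
  obtain ⟨C, hC, hle⟩ := h.exists_div_le_rpow hρ ha
  have hpos : ∀ n : ℕ, 1 ≤ n → (0 : ℝ) < n := fun n hn => by exact_mod_cast hn
  have hlim := tendsto_sum_div (x := fun n i => ((i : ℝ) / n)⁻¹ * (a i / a n))
    (L := fun u => u⁻¹ * u ^ α) (C := C) hρ0 (min_le_right _ _) (fun n i hi hin => by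
      have h1 := hpos i hi
      have h2 := hpos n (hi.trans hin)
      have h3 := ha i hi
      have h4 := ha n (hi.trans hin)
      rw [abs_of_nonneg (by positivity), Real.rpow_sub_one (by positivity),
        inv_mul_eq_div, ← mul_div_assoc]
      exact div_le_div_of_nonneg_right (hle n i hi hin) (by positivity)) (fun u hu _ => by
      refine Tendsto.mul (Tendsto.inv₀ ?_ hu.ne') (h.tendsto_floor_succ ha hu)
      have h1 := (tendsto_floor_mul_div hu).add tendsto_inv_atTop_nhds_zero_nat
      rw [add_zero] at h1
      refine h1.congr fun n => ?_
      push_cast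
      ring)
  have hint : ∫ u in (0 : ℝ)..1, u⁻¹ * u ^ α = α⁻¹ := by
    have : ∫ u in (0 : ℝ)..1, u⁻¹ * u ^ α = ∫ u in (0 : ℝ)..1, u ^ (α - 1) := by
      refine intervalIntegral.integral_congr_ae (ae_of_all _ fun u hu => ?_)
      rw [Set.uIoc_of_le zero_le_one] at hu
      rw [Real.rpow_sub_one hu.1.ne', inv_mul_eq_div]
    rw [this, integral_rpow (Or.inl (by linarith))]
    simp [Real.zero_rpow hα.ne']
  rw [hint] at hlim
  refine hlim.congr' ?_
  filter_upwards [eventually_ge_atTop 1] with n hn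
  have hn' := hpos n hn
  rw [weightedSum, Finset.sum_div, Finset.sum_div]
  refine Finset.sum_congr rfl fun i hi => ?_
  have := hpos i (Finset.mem_Icc.1 hi).1
  field_simp

/-- In the slowly varying case the terms are negligible with respect to the weighted sums. -/
lemma RegularlyVarying.tendsto_div_weightedSum_zero (ha : ∀ n, 1 ≤ n → 0 < a n)
    (h : RegularlyVarying a 0) :
    Tendsto (fun n : ℕ => a n / weightedSum a n) atTop (𝓝 0) := by
  obtain ⟨C, hC, hle⟩ := h.exists_div_le_rpow (ρ := -(1 / 2)) (by norm_num) ha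
  have hpos : ∀ n : ℕ, 1 ≤ n → (0 : ℝ) < n := fun n hn => by exact_mod_cast hn
  suffices hsuff : Tendsto (fun n : ℕ => weightedSum a n / a n) atTop atTop by
    refine hsuff.inv_tendsto_atTop.congr fun n => ?_
    simp
  rw [tendsto_atTop]
  intro b
  -- Now `u⁻¹` is not integrable at `0`, so it is truncated at `δ⁻¹`. On `[δ, 1]` alone its integral
  -- is `log δ⁻¹ = max b 0 + 1 > b`.
  set δ : ℝ := Real.exp (-(max b 0 + 1))
  have hδ : 0 < δ := Real.exp_pos _
  have hδ1 : δ ≤ 1 := Real.exp_le_one_iff.2 (by have := le_max_right b 0; linarith)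
  have hlim := tendsto_sum_div (x := fun n i => min ((i : ℝ) / n)⁻¹ δ⁻¹ * (a i / a n))
    (L := fun u => min u⁻¹ δ⁻¹ * u ^ (0 : ℝ)) (C := δ⁻¹ * C) (γ := 1 / 2) (by norm_num)
    (by norm_num) (fun n i hi hin => by
      have h1 := hpos i hi
      have h2 := hpos n (hi.trans hin)
      have h3 := ha i hi
      have h4 := ha n (hi.trans hin)
      rw [abs_of_nonneg (by positivity), mul_assoc]
      gcongr
      · exact min_le_right _ _
      · rw [show (1 / 2 - 1 : ℝ) = -(1 / 2) by norm_num]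
        exact hle n i hi hin) (fun u hu _ => by
      refine Tendsto.mul (Tendsto.min (Tendsto.inv₀ ?_ hu.ne') tendsto_const_nhds)
        (h.tendsto_floor_succ ha hu)
      have h1 := (tendsto_floor_mul_div hu).add tendsto_inv_atTop_nhds_zero_nat
      rw [add_zero] at h1
      refine h1.congr fun n => ?_
      push_cast
      ring)
  have hint : b < ∫ u in (0 : ℝ)..1, min u⁻¹ δ⁻¹ * u ^ (0 : ℝ) := by
    have hmeas : Measurable fun u : ℝ => min u⁻¹ δ⁻¹ := measurable_inv.min measurable_const
    have hi : IntervalIntegrable (fun u : ℝ => min u⁻¹ δ⁻¹) volume 0 1 := by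
      rw [intervalIntegrable_iff]
      refine IntegrableOn.of_bound (by simp) hmeas.aestronglyMeasurable δ⁻¹ ?_
      filter_upwards [ae_restrict_mem measurableSet_uIoc] with u hu
      rw [Set.uIoc_of_le zero_le_one] at hu
      have := hu.1
      rw [Real.norm_eq_abs, abs_of_nonneg (by positivity)]
      exact min_le_right _ _
    simp only [Real.rpow_zero, mul_one]
    have hsplit := intervalIntegral.integral_add_adjacent_intervals
      (hi.mono_set (c := 0) (d := δ) (by
        rw [Set.uIcc_of_le hδ.le, Set.uIcc_of_le zero_le_one]; exact Set.Icc_subset_Icc_right hδ1))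
      (hi.mono_set (c := δ) (d := 1) (by
        rw [Set.uIcc_of_le hδ1, Set.uIcc_of_le zero_le_one]; exact Set.Icc_subset_Icc_left hδ.le))
    have h1 : 0 ≤ ∫ u in (0 : ℝ)..δ, min u⁻¹ δ⁻¹ :=
      intervalIntegral.integral_nonneg hδ.le fun u hu => by have := hu.1; positivity
    have h2 : ∫ u in δ..1, min u⁻¹ δ⁻¹ = max b 0 + 1 := by
      have : ∫ u in δ..1, min u⁻¹ δ⁻¹ = ∫ u in δ..1, u⁻¹ := by
        refine intervalIntegral.integral_congr fun u hu => ?_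
        rw [Set.uIcc_of_le hδ1] at hu
        exact min_eq_left (inv_anti₀ hδ hu.1)
      rw [this, integral_inv_of_pos hδ one_pos]
      simp [δ, Real.log_inv]
    have := le_max_left b 0
    linarith
  filter_upwards [hlim.eventually_const_lt hint, eventually_ge_atTop 1] with n hn hn1
  refine hn.le.trans ?_
  have hn' := hpos n hn1
  rw [weightedSum, Finset.sum_div, Finset.sum_div]
  refine Finset.sum_le_sum fun i hi => ?_
  have h1 := hpos i (Finset.mem_Icc.1 hi).1
  have h2 := ha i (Finset.mem_Icc.1 hi).1
  have h3 := ha n hn1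
  calc min ((i : ℝ) / n)⁻¹ δ⁻¹ * (a i / a n) / n ≤ ((i : ℝ) / n)⁻¹ * (a i / a n) / n := by
        gcongr
        exact min_le_left _ _
    _ = (i : ℝ)⁻¹ * a i / a n := by field_simp

end

/-! ### The moment generating function of the heights -/

/-- The moment generating function of the uniform law on `[0, 1]`. -/
noncomputable def unifMGF (x : ℝ) : ℝ := ∫ s in (0 : ℝ)..1, Real.exp (x * s)

lemma mul_unifMGF (x : ℝ) : x * unifMGF x = Real.exp x - 1 := by
  simp [unifMGF]

lemma integral_exp_mul {c : ℝ} (t : ℝ) :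
    ∫ s in (0 : ℝ)..c, Real.exp (t * s) = c * unifMGF (t * c) := by
  have h := intervalIntegral.mul_integral_comp_mul_left (a := 0) (b := 1)
    (f := fun s => Real.exp (t * s)) c
  rw [mul_zero, mul_one] at h
  simp only [unifMGF, ← h, mul_assoc]

lemma unifMGF_zero : unifMGF 0 = 1 := by simp [unifMGF]

lemma unifMGF_mono : Monotone unifMGF := by
  intro x y hxy
  refine intervalIntegral.integral_mono_on zero_le_one
    (Continuous.intervalIntegrable (by fun_prop) _ _)
    (Continuous.intervalIntegrable (by fun_prop) _ _) fun s hs => ?_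
  exact Real.exp_le_exp.2 (mul_le_mul_of_nonneg_right hxy hs.1)

lemma unifMGF_pos (x : ℝ) : 0 < unifMGF x :=
  intervalIntegral.intervalIntegral_pos_of_pos (Continuous.intervalIntegrable (by fun_prop) _ _)
    (fun _ => Real.exp_pos _) zero_lt_one

lemma continuous_unifMGF : Continuous unifMGF :=
  intervalIntegral.continuous_parametric_intervalIntegral_of_continuous' (by fun_prop) 0 1

lemma abs_exp_sub_one_le_mul_exp (y : ℝ) : |Real.exp y - 1| ≤ |y| * Real.exp |y| := by
  have h := Complex.norm_exp_sub_sum_le_norm_mul_exp (y : ℂ) 1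
  simp only [Finset.range_one, Finset.sum_singleton, pow_zero, Nat.factorial_zero, Nat.cast_one,
    div_one, pow_one, Complex.norm_real, Real.norm_eq_abs] at h
  rwa [← Complex.ofReal_exp, ← Complex.ofReal_one, ← Complex.ofReal_sub, Complex.norm_real,
    Real.norm_eq_abs] at h

lemma abs_exp_sub_one_sub_le_mul_exp (y : ℝ) :
    |Real.exp y - 1 - y| ≤ y ^ 2 * Real.exp |y| := by
  have h := Complex.norm_exp_sub_sum_le_norm_mul_exp (y : ℂ) 2
  simp only [Finset.sum_range_succ, Finset.range_zero, Finset.sum_empty, zero_add, pow_zero,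
    Nat.factorial_zero, Nat.factorial_one, Nat.cast_one,
    div_one, pow_one, Complex.norm_real, Real.norm_eq_abs, sq_abs] at h
  rwa [← Complex.ofReal_exp, ← Complex.ofReal_one, ← Complex.ofReal_add, ← Complex.ofReal_sub,
    Complex.norm_real, Real.norm_eq_abs, ← sub_sub] at h

lemma abs_unifMGF_sub_one_le (x : ℝ) : |unifMGF x - 1| ≤ |x| * Real.exp |x| := by
  have h1 : unifMGF x - 1 = ∫ s in (0 : ℝ)..1, (Real.exp (x * s) - 1) := by
    rw [intervalIntegral.integral_sub (Continuous.intervalIntegrable (by fun_prop) _ _) (by simp)]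
    simp [unifMGF]
  rw [h1, ← Real.norm_eq_abs]
  have := intervalIntegral.norm_integral_le_of_norm_le_const (a := 0) (b := 1)
    (f := fun s : ℝ => Real.exp (x * s) - 1) (C := |x| * Real.exp |x|) fun s hs => by
      rw [Set.uIoc_of_le zero_le_one] at hs
      have hxs : |x * s| ≤ |x| := by
        rw [abs_mul, abs_of_pos hs.1]
        exact mul_le_of_le_one_right (abs_nonneg _) hs.2
      refine (abs_exp_sub_one_le_mul_exp _).trans ?_
      gcongr
  simpa using this

lemma abs_unifMGF_sub_sub_le (x : ℝ) : |unifMGF x - 1 - x / 2| ≤ x ^ 2 * Real.exp |x| := by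
  have h1 : unifMGF x - 1 - x / 2 = ∫ s in (0 : ℝ)..1, (Real.exp (x * s) - 1 - x * s) := by
    rw [intervalIntegral.integral_sub (Continuous.intervalIntegrable (by fun_prop) _ _)
      (Continuous.intervalIntegrable (by fun_prop) _ _),
      intervalIntegral.integral_sub (Continuous.intervalIntegrable (by fun_prop) _ _) (by simp)]
    rw [intervalIntegral.integral_const_mul]
    simp [unifMGF, div_eq_mul_inv]
  rw [h1, ← Real.norm_eq_abs]
  have := intervalIntegral.norm_integral_le_of_norm_le_const (a := 0) (b := 1)
    (f := fun s : ℝ => Real.exp (x * s) - 1 - x * s) (C := x ^ 2 * Real.exp |x|) fun s hs => by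
      rw [Set.uIoc_of_le zero_le_one] at hs
      have hxs : |x * s| ≤ |x| := by
        rw [abs_mul, abs_of_pos hs.1]
        exact mul_le_of_le_one_right (abs_nonneg _) hs.2
      refine (abs_exp_sub_one_sub_le_mul_exp _).trans ?_
      have := sq_le_sq.2 hxs
      gcongr
  simpa using this

/-! #### Measurability of the distance -/

lemma measurable_treeDist (n : ℕ) :
    Measurable fun x : (ℕ → Pt) × Pt × Pt => treeDist x.1 n x.2.1 x.2.2 := by
  induction n with
  | zero => simpa only [treeDist] using measurable_const
  | succ n ih =>
    simp only [treeDist]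
    have hp : MeasurableSet {x : (ℕ → Pt) × Pt × Pt | x.2.1.1 = n + 1} :=
      (measurable_fst.comp (measurable_fst.comp measurable_snd)) (measurableSet_singleton (n + 1))
    have hq : MeasurableSet {x : (ℕ → Pt) × Pt × Pt | x.2.2.1 = n + 1} :=
      (measurable_fst.comp (measurable_snd.comp measurable_snd)) (measurableSet_singleton (n + 1))
    have hy : Measurable fun x : (ℕ → Pt) × Pt × Pt => x.1 n :=
      (measurable_pi_apply n).comp measurable_fst
    refine Measurable.ite hp (Measurable.ite hq ?_ ?_) (Measurable.ite hq ?_ ih)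
    · exact Measurable.abs (by fun_prop)
    · refine Measurable.add (by fun_prop) ?_
      exact ih.comp (measurable_fst.prodMk (hy.prodMk (by fun_prop)))
    · refine Measurable.add ?_ (by fun_prop)
      exact ih.comp (measurable_fst.prodMk ((by fun_prop : Measurable _).prodMk hy))

/-- The heights in `T_n` only depend on the gluing points `y 1, …, y (n - 1)`. -/
lemma treeDist_congr {y y' : ℕ → Pt} {n : ℕ} (h : ∀ i, 1 ≤ i → i < n → y i = y' i) (p : Pt) :
    treeDist y n p root = treeDist y' n p root := by
  induction n generalizing p with
  | zero => rfl
  | succ n ih =>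
    have ih' := ih fun i h1 h2 => h i h1 (by omega)
    rcases Nat.eq_zero_or_pos n with rfl | hn
    · simp [treeDist, root]
    · have hroot : root.1 ≠ n + 1 := by simp [root]; omega
      simp only [treeDist, hroot, if_false]
      rw [h n hn (by omega), ih', ih']

/-! ### The product formula for the height of a uniform point -/

section

variable {Ω : Type*} [MeasurableSpace Ω] {a : ℕ → ℝ} {P : Measure Ω} {Y : ℕ → Ω → Pt}

lemma lengthMeasure_univ (ha : ∀ n, 1 ≤ n → 0 < a n) (n : ℕ) :
    lengthMeasure a n Set.univ = ENNReal.ofReal (totalLength a n) := by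
  rw [totalLength, ENNReal.ofReal_sum_of_nonneg fun i hi => (ha i (Finset.mem_Icc.1 hi).1).le,
    lengthMeasure, Measure.finsetSum_apply]
  refine Finset.sum_congr rfl fun i _ => ?_
  rw [Measure.map_apply (by fun_prop) MeasurableSet.univ]
  simp

lemma isProbabilityMeasure_uniformLaw (ha : ∀ n, 1 ≤ n → 0 < a n) {n : ℕ} (hn : 1 ≤ n) :
    IsProbabilityMeasure (uniformLaw a n) := by
  refine ⟨?_⟩
  rw [uniformLaw, Measure.smul_apply, lengthMeasure_univ ha, smul_eq_mul]
  exact ENNReal.inv_mul_cancel (by simpa using totalLength_pos ha hn) ENNReal.ofReal_ne_top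

lemma lengthMeasure_succ (a : ℕ → ℝ) (n : ℕ) :
    lengthMeasure a (n + 1) = lengthMeasure a n +
      (volume.restrict (Set.Icc 0 (a (n + 1)))).map (fun t : ℝ => ((n + 1, t) : Pt)) :=
  Finset.sum_Icc_succ_top (by omega) _

/-- The gluing points of `T_n`, extended by an arbitrary value. -/
def extendGluing (n : ℕ) (y : Finset.Ico 1 n → Pt) (i : ℕ) : Pt :=
  if h : i ∈ Finset.Ico 1 n then y ⟨i, h⟩ else root

lemma measurable_extendGluing (n : ℕ) : Measurable (extendGluing n) := by
  refine measurable_pi_lambda _ fun i => ?_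
  by_cases h : i ∈ Finset.Ico 1 n
  · simpa only [extendGluing, h, dif_pos] using measurable_pi_apply _
  · simpa only [extendGluing, h, dif_neg, not_false_eq_true] using measurable_const

lemma treeDist_extendGluing (n : ℕ) (y : ℕ → Pt) (p : Pt) :
    treeDist (extendGluing n fun i => y i) n p root = treeDist y n p root := by
  refine treeDist_congr (fun i h1 h2 => ?_) p
  simp [extendGluing, h1, h2]

/-- `UniformOnTree` gives measurability of the finite family `Y 1, …, Y (n - 1)` only, while
`treeDist` takes a whole sequence. The family is therefore extended by a constant, which leaves the
height unchanged. -/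
lemma UniformOnTree.aemeasurable_height {Z : Ω → Pt} {n : ℕ} (hZ : UniformOnTree a P Y n Z) :
    AEMeasurable (fun ω => treeDist (fun i => Y i ω) n (Z ω) root) P := by
  have h1 : AEMeasurable (fun ω => (extendGluing n fun i => Y i ω, Z ω, root)) P :=
    ((measurable_extendGluing n).comp_aemeasurable (HasCondDistrib.aemeasurable_fst hZ)).prodMk
      ((HasCondDistrib.aemeasurable_snd hZ).prodMk aemeasurable_const)
  refine ((measurable_treeDist n).comp_aemeasurable h1).congr (ae_of_all _ fun ω => ?_)
  exact treeDist_extendGluing n (fun i => Y i ω) (Z ω)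

/-- The height of a uniform point is obtained by averaging over a point which is independent of
the tree. -/
lemma UniformOnTree.lintegral_height (ha : ∀ n, 1 ≤ n → 0 < a n) [IsProbabilityMeasure P]
    {Z : Ω → Pt} {n : ℕ} (hn : 1 ≤ n)
    (hZ : UniformOnTree a P Y n Z) {F : ℝ → ENNReal} (hF : Measurable F) :
    ∫⁻ ω, F (treeDist (fun i => Y i ω) n (Z ω) root) ∂P =
      ∫⁻ z, ∫⁻ ω, F (treeDist (fun i => Y i ω) n z root) ∂P ∂(uniformLaw a n) := by
  have := isProbabilityMeasure_uniformLaw ha hn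
  set G : (Finset.Ico 1 n → Pt) × Pt → ENNReal :=
    fun x => F (treeDist (extendGluing n x.1) n x.2 root) with hG
  have hGm : Measurable G := by
    have h1 : Measurable fun x : (Finset.Ico 1 n → Pt) × Pt => (extendGluing n x.1, x.2, root) :=
      ((measurable_extendGluing n).comp measurable_fst).prodMk
        (measurable_snd.prodMk measurable_const)
    exact hF.comp ((measurable_treeDist n).comp h1)
  have hY := HasCondDistrib.aemeasurable_fst hZ
  -- A constant conditional law means independence: the joint law is a product, and Tonelli applies.
  have hmap : P.map (fun ω => ((fun i : Finset.Ico 1 n => Y i ω), Z ω)) =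
      (P.map fun ω (i : Finset.Ico 1 n) => Y i ω).prod (uniformLaw a n) := by
    rw [HasLaw.map_eq hZ, Measure.compProd_const]
  have := Measure.isProbabilityMeasure_map hY
  calc ∫⁻ ω, F (treeDist (fun i => Y i ω) n (Z ω) root) ∂P
      = ∫⁻ ω, G ((fun i : Finset.Ico 1 n => Y i ω), Z ω) ∂P :=
        lintegral_congr fun ω => congrArg F (treeDist_extendGluing n (fun i => Y i ω) _).symm
    _ = ∫⁻ x, G x ∂((P.map fun ω (i : Finset.Ico 1 n) => Y i ω).prod (uniformLaw a n)) := by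
        rw [← hmap, lintegral_map' hGm.aemeasurable (HasLaw.aemeasurable hZ)]
    _ = ∫⁻ z, ∫⁻ y, G (y, z) ∂(P.map fun ω (i : Finset.Ico 1 n) => Y i ω) ∂(uniformLaw a n) :=
        lintegral_prod_symm _ hGm.aemeasurable
    _ = _ := by
        refine lintegral_congr fun z => ?_
        have h1 : Measurable fun y => G (y, z) := hGm.comp measurable_prodMk_right
        rw [lintegral_map' h1.aemeasurable hY]
        exact lintegral_congr fun ω => congrArg F (treeDist_extendGluing n (fun i => Y i ω) _)

lemma ae_lengthMeasure_index_le (a : ℕ → ℝ) (n : ℕ) : ∀ᵐ z ∂(lengthMeasure a n), z.1 ≤ n := by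
  rw [ae_iff, lengthMeasure, Measure.finsetSum_apply]
  refine Finset.sum_eq_zero fun i hi => ?_
  rw [(measurableEmbedding_prodMk_left i).map_apply]
  have hin := (Finset.mem_Icc.1 hi).2
  have : (fun t : ℝ => ((i, t) : Pt)) ⁻¹' {z | ¬ z.1 ≤ n} = ∅ := by
    ext t
    simpa using hin
  rw [this, measure_empty]

lemma lintegral_exp_mul_Icc {c : ℝ} (hc : 0 ≤ c) (t : ℝ) :
    ∫⁻ s in Set.Icc 0 c, ENNReal.ofReal (Real.exp (t * s)) =
      ENNReal.ofReal (c * unifMGF (t * c)) := by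
  have hint : IntegrableOn (fun s : ℝ => Real.exp (t * s)) (Set.Icc 0 c) :=
    Continuous.integrableOn_Icc (by fun_prop)
  rw [← ofReal_integral_eq_lintegral_ofReal hint (ae_of_all _ fun s => Real.exp_nonneg _),
    integral_Icc_eq_integral_Ioc, ← intervalIntegral.integral_of_le hc, integral_exp_mul]

/-- The moment generating function of the height of a uniform point of `T_n`. -/
noncomputable def heightMGF (a : ℕ → ℝ) (n : ℕ) (t : ℝ) : ℝ :=
  ∏ i ∈ Finset.Icc 1 n, (1 + lastProb a i * (unifMGF (t * a i) - 1))

lemma one_add_mul_unifMGF_pos {p : ℝ} (hp : 0 ≤ p) (hp1 : p ≤ 1) (x : ℝ) :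
    0 < 1 + p * (unifMGF x - 1) := by
  have := unifMGF_pos x
  rcases hp1.eq_or_lt with rfl | h
  · linarith
  · nlinarith

lemma heightMGF_pos (ha : ∀ n, 1 ≤ n → 0 < a n) (n : ℕ) (t : ℝ) : 0 < heightMGF a n t :=
  Finset.prod_pos fun _ hi =>
    one_add_mul_unifMGF_pos (lastProb_nonneg ha (Finset.mem_Icc.1 hi).1)
      (lastProb_le_one ha (Finset.mem_Icc.1 hi).1) _

/-- Induction on `n`, splitting the length measure of `T_(n+1)` into that of `T_n` and that of the
new segment. The gluing point has the same height law as any uniform point of `T_n`, so the new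
segment contributes the previous generating function times that of a uniform variable on `[0, a (n +
1)]`. -/
lemma lintegral_exp_height (ha : ∀ n, 1 ≤ n → 0 < a n) [IsProbabilityMeasure P]
    (hY : IsGluing a P Y) (t : ℝ) {n : ℕ} (hn : 1 ≤ n) {Z : Ω → Pt}
    (hZ : UniformOnTree a P Y n Z) :
    ∫⁻ ω, ENNReal.ofReal (Real.exp (t * treeDist (fun i => Y i ω) n (Z ω) root)) ∂P =
      ENNReal.ofReal (heightMGF a n t) := by
  have hF : Measurable fun x : ℝ => ENNReal.ofReal (Real.exp (t * x)) := by fun_prop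
  -- Once the marked point is integrated out, only the gluing points remain, and the unnormalized
  -- length measure is additive in `n`. This is the form that passes through the induction.
  suffices hJ : ∀ n, 1 ≤ n →
      ∫⁻ z, ∫⁻ ω, ENNReal.ofReal (Real.exp (t * treeDist (fun i => Y i ω) n z root)) ∂P
        ∂(lengthMeasure a n) = ENNReal.ofReal (totalLength a n * heightMGF a n t) by
    rw [hZ.lintegral_height ha hn hF, uniformLaw, lintegral_smul_measure, hJ n hn,
      lengthMeasure_univ ha, smul_eq_mul, ENNReal.ofReal_mul (totalLength_nonneg ha n), ← mul_assoc,
      ENNReal.inv_mul_cancel (by simpa using totalLength_pos ha hn) ENNReal.ofReal_ne_top, one_mul]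
  clear hZ hn
  intro n hn
  induction n, hn using Nat.le_induction with
  | base =>
    have h1 : lengthMeasure a 1 =
        (volume.restrict (Set.Icc 0 (a 1))).map (fun t : ℝ => ((1, t) : Pt)) := by
      simp [lengthMeasure]
    rw [h1, (measurableEmbedding_prodMk_left 1).lintegral_map]
    have h2 : totalLength a 1 * heightMGF a 1 t = a 1 * unifMGF (t * a 1) := by
      simp [heightMGF, lastProb_one ha, totalLength]
    rw [h2, ← lintegral_exp_mul_Icc (ha 1 le_rfl).le]
    refine setLIntegral_congr_fun measurableSet_Icc fun s hs => ?_
    simp [treeDist, root, abs_of_nonneg hs.1]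
  | succ n hn ih =>
    have hroot : root.1 ≠ n + 1 := by simp [root]; omega
    have hE : ∫⁻ ω, ENNReal.ofReal (Real.exp (t * treeDist (fun i => Y i ω) n (Y n ω) root)) ∂P =
        ENNReal.ofReal (heightMGF a n t) := by
      rw [(hY n hn).lintegral_height ha hn hF, uniformLaw, lintegral_smul_measure, ih,
        lengthMeasure_univ ha, smul_eq_mul, ENNReal.ofReal_mul (totalLength_nonneg ha n),
        ← mul_assoc,
        ENNReal.inv_mul_cancel (by simpa using totalLength_pos ha hn) ENNReal.ofReal_ne_top,
        one_mul]
    have hold : ∫⁻ z, ∫⁻ ω, ENNReal.ofReal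
          (Real.exp (t * treeDist (fun i => Y i ω) (n + 1) z root)) ∂P ∂(lengthMeasure a n) =
        ENNReal.ofReal (totalLength a n * heightMGF a n t) := by
      rw [← ih]
      refine lintegral_congr_ae ?_
      filter_upwards [ae_lengthMeasure_index_le a n] with z hz
      have hz' : z.1 ≠ n + 1 := by omega
      simp only [treeDist, hroot, hz', if_false]
    have hnew : ∫⁻ s in Set.Icc 0 (a (n + 1)), ∫⁻ ω, ENNReal.ofReal
          (Real.exp (t * treeDist (fun i => Y i ω) (n + 1) (n + 1, s) root)) ∂P =
        ENNReal.ofReal (a (n + 1) * unifMGF (t * a (n + 1)) * heightMGF a n t) := by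
      simp only [treeDist, hroot, if_false, if_true, mul_add, Real.exp_add,
        ENNReal.ofReal_mul (Real.exp_nonneg _)]
      simp only [lintegral_const_mul' _ _ ENNReal.ofReal_ne_top, hE]
      rw [lintegral_mul_const' _ _ ENNReal.ofReal_ne_top,
        lintegral_exp_mul_Icc (ha _ (Nat.le_add_left 1 n)).le,
        ENNReal.ofReal_mul' (heightMGF_pos ha n t).le]
    rw [lengthMeasure_succ, lintegral_add_measure, hold,
      (measurableEmbedding_prodMk_left (n + 1)).lintegral_map, hnew, ← ENNReal.ofReal_add]
    · congr 1
      have hA : totalLength a (n + 1) ≠ 0 := (totalLength_pos ha (Nat.le_add_left 1 n)).ne'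
      have hprod : heightMGF a (n + 1) t =
          heightMGF a n t * (1 + lastProb a (n + 1) * (unifMGF (t * a (n + 1)) - 1)) :=
        Finset.prod_Icc_succ_top (by omega) _
      have hA' : totalLength a n = totalLength a (n + 1) - a (n + 1) := by
        rw [totalLength_succ]; ring
      rw [hprod, lastProb, hA']
      field_simp
      ring
    · exact mul_nonneg (totalLength_nonneg ha n) (heightMGF_pos ha n t).le
    · exact mul_nonneg (mul_nonneg (ha _ (Nat.le_add_left 1 n)).le (unifMGF_pos _).le)
        (heightMGF_pos ha n t).le

lemma integrable_exp_height (ha : ∀ n, 1 ≤ n → 0 < a n) [IsProbabilityMeasure P]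
    (hY : IsGluing a P Y) (t : ℝ) {n : ℕ} (hn : 1 ≤ n) {Z : Ω → Pt}
    (hZ : UniformOnTree a P Y n Z) :
    Integrable (fun ω => Real.exp (t * treeDist (fun i => Y i ω) n (Z ω) root)) P ∧
      ∫ ω, Real.exp (t * treeDist (fun i => Y i ω) n (Z ω) root) ∂P = heightMGF a n t := by
  have h := lintegral_exp_height ha hY t hn hZ
  have hm : AEStronglyMeasurable
      (fun ω => Real.exp (t * treeDist (fun i => Y i ω) n (Z ω) root)) P :=
    (Real.measurable_exp.comp_aemeasurable (hZ.aemeasurable_height.const_mul t)).aestronglyMeasurable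
  constructor
  · refine ⟨hm, ?_⟩
    rw [hasFiniteIntegral_iff_ofReal (ae_of_all _ fun x => Real.exp_nonneg _), h]
    exact ENNReal.ofReal_lt_top
  · rw [integral_eq_lintegral_of_nonneg_ae (ae_of_all _ fun x => Real.exp_nonneg _) hm, h,
      ENNReal.toReal_ofReal (heightMGF_pos ha n t).le]

end

/-! ### Limits of the moment generating functions -/

lemma abs_log_le_div {w δ : ℝ} (hδ : 0 < δ) (hδ1 : δ ≤ 1) (hw : δ ≤ w) :
    |Real.log w| ≤ |w - 1| / δ := by
  have hw0 := hδ.trans_le hw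
  have h1 : Real.log w ≤ w - 1 := Real.log_le_sub_one_of_pos hw0
  have h2 : 1 - w⁻¹ ≤ Real.log w := Real.one_sub_inv_le_log_of_pos hw0
  rw [le_div_iff₀ hδ]
  have h3 : w * (1 - w⁻¹) = w - 1 := by field_simp
  rcases le_total 1 w with h | h
  · have := Real.log_nonneg h
    rw [abs_of_nonneg this, abs_of_nonneg (by linarith)]
    nlinarith
  · have := Real.log_nonpos hw0.le h
    rw [abs_of_nonpos this, abs_of_nonpos (by linarith)]
    nlinarith

lemma abs_log_sub_le_div {w δ : ℝ} (hδ : 0 < δ) (hw : δ ≤ w) :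
    |Real.log w - (w - 1)| ≤ (w - 1) ^ 2 / δ := by
  have hw0 := hδ.trans_le hw
  have h1 : Real.log w ≤ w - 1 := Real.log_le_sub_one_of_pos hw0
  have h2 : 1 - w⁻¹ ≤ Real.log w := Real.one_sub_inv_le_log_of_pos hw0
  rw [abs_of_nonpos (by linarith)]
  have h3 : (w - 1) ^ 2 / w ≤ (w - 1) ^ 2 / δ := by gcongr
  have h4 : (w - 1) ^ 2 / w = (w - 1) - (1 - w⁻¹) := by
    field_simp
  linarith

/-- The factor is a mixture of `1` and `unifMGF x`, both at least `unifMGF (-K)`. Staying away from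
`0` uniformly is what makes the logarithm controllable. -/
lemma unifMGF_neg_le_one_add {p x K : ℝ} (hp : 0 ≤ p) (hp1 : p ≤ 1) (hx : |x| ≤ K) :
    unifMGF (-K) ≤ 1 + p * (unifMGF x - 1) := by
  have h1 : unifMGF (-K) ≤ unifMGF x := unifMGF_mono (abs_le.1 hx).1
  have h2 : unifMGF (-K) ≤ 1 := by
    rw [← unifMGF_zero]
    exact unifMGF_mono (by have := (abs_nonneg x).trans hx; linarith)
  nlinarith

lemma exists_abs_log_le (K : ℝ) : ∃ B, 0 < B ∧ ∀ p x : ℝ, 0 ≤ p → p ≤ 1 → |x| ≤ K →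
    |Real.log (1 + p * (unifMGF x - 1))| ≤ B * (p * |x|) := by
  rcases lt_or_ge K 0 with hK | hK
  · exact ⟨1, one_pos, fun p x _ _ hx => absurd ((abs_nonneg x).trans hx) (by linarith)⟩
  have hδ := unifMGF_pos (-K)
  have hδ1 : unifMGF (-K) ≤ 1 := by
    rw [← unifMGF_zero]
    exact unifMGF_mono (by linarith)
  refine ⟨Real.exp K / unifMGF (-K), by positivity, fun p x hp hp1 hx => ?_⟩
  refine (abs_log_le_div hδ hδ1 (unifMGF_neg_le_one_add hp hp1 hx)).trans ?_
  rw [add_sub_cancel_left, abs_mul, abs_of_nonneg hp, div_mul_eq_mul_div]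
  refine div_le_div_of_nonneg_right ?_ hδ.le
  calc p * |unifMGF x - 1| ≤ p * (|x| * Real.exp |x|) := by
        gcongr
        exact abs_unifMGF_sub_one_le x
    _ ≤ p * (|x| * Real.exp K) := by gcongr
    _ = Real.exp K * (p * |x|) := by ring

/-- The second order version of `exists_abs_log_le`: the linear term `p * (x / 2)` comes from the
mean `1/2` of the uniform law. -/
lemma exists_abs_log_sub_le (K : ℝ) : ∃ B, 0 < B ∧ ∀ p x : ℝ, 0 ≤ p → p ≤ 1 → |x| ≤ K →
    |Real.log (1 + p * (unifMGF x - 1)) - p * (x / 2)| ≤ B * (p * x ^ 2) := by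
  have hδ := unifMGF_pos (-K)
  refine ⟨Real.exp K ^ 2 / unifMGF (-K) + Real.exp K, by positivity, fun p x hp hp1 hx => ?_⟩
  have h1 := abs_log_sub_le_div hδ (unifMGF_neg_le_one_add hp hp1 hx)
  rw [add_sub_cancel_left] at h1
  have hexp : Real.exp |x| ≤ Real.exp K := Real.exp_le_exp.2 hx
  have h2 : (p * (unifMGF x - 1)) ^ 2 ≤ Real.exp K ^ 2 * (p * x ^ 2) := by
    have h3 : |unifMGF x - 1| ≤ |x| * Real.exp K :=
      (abs_unifMGF_sub_one_le x).trans (by gcongr)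
    have h4 : (unifMGF x - 1) ^ 2 ≤ x ^ 2 * Real.exp K ^ 2 := by
      rw [← sq_abs, ← sq_abs x, ← mul_pow]
      gcongr
    have h5 : p ^ 2 ≤ p := by nlinarith
    calc (p * (unifMGF x - 1)) ^ 2 = p ^ 2 * (unifMGF x - 1) ^ 2 := by ring
      _ ≤ p * (x ^ 2 * Real.exp K ^ 2) := by gcongr
      _ = _ := by ring
  have h3 : |p * (unifMGF x - 1 - x / 2)| ≤ Real.exp K * (p * x ^ 2) := by
    rw [abs_mul, abs_of_nonneg hp]
    calc p * |unifMGF x - 1 - x / 2| ≤ p * (x ^ 2 * Real.exp |x|) := by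
          gcongr
          exact abs_unifMGF_sub_sub_le x
      _ ≤ p * (x ^ 2 * Real.exp K) := by gcongr
      _ = _ := by ring
  calc |Real.log (1 + p * (unifMGF x - 1)) - p * (x / 2)|
      = |(Real.log (1 + p * (unifMGF x - 1)) - p * (unifMGF x - 1)) +
          p * (unifMGF x - 1 - x / 2)| := by ring_nf
    _ ≤ (p * (unifMGF x - 1)) ^ 2 / unifMGF (-K) + Real.exp K * (p * x ^ 2) :=
        (abs_add_le _ _).trans (add_le_add h1 h3)
    _ ≤ Real.exp K ^ 2 * (p * x ^ 2) / unifMGF (-K) + Real.exp K * (p * x ^ 2) := by gcongr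
    _ = _ := by ring

section

variable {a : ℕ → ℝ} {α : ℝ}

lemma exp_sum_log_eq_heightMGF (ha : ∀ n, 1 ≤ n → 0 < a n) (n : ℕ) (t : ℝ) :
    Real.exp (∑ i ∈ Finset.Icc 1 n,
      Real.log (1 + lastProb a i * (unifMGF (t / weightedSum a n * a i) - 1))) =
    heightMGF a n (t / weightedSum a n) := by
  rw [Real.exp_sum]
  refine Finset.prod_congr rfl fun i hi => Real.exp_log ?_
  exact one_add_mul_unifMGF_pos (lastProb_nonneg ha (Finset.mem_Icc.1 hi).1)
    (lastProb_le_one ha (Finset.mem_Icc.1 hi).1) _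

/-! #### Positive index -/

lemma intervalIntegrable_expKernel (x : ℝ) :
    IntervalIntegrable (fun u : ℝ => (Real.exp (x * u) - 1) * ((1 - u) / u)) volume 0 1 := by
  rw [intervalIntegrable_iff]
  refine IntegrableOn.of_bound (C := |x| * Real.exp |x|) (by simp)
    (Measurable.aestronglyMeasurable (by fun_prop)) ?_
  filter_upwards [ae_restrict_mem measurableSet_uIoc] with u hu
  rw [Set.uIoc_of_le zero_le_one] at hu
  have hu0 := hu.1
  have hxu : |x * u| ≤ |x| := by
    rw [abs_mul, abs_of_pos hu.1]
    exact mul_le_of_le_one_right (abs_nonneg _) hu.2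
  rw [norm_mul, Real.norm_eq_abs, Real.norm_eq_abs,
    abs_of_nonneg (div_nonneg (by linarith [hu.2]) hu.1.le)]
  calc |Real.exp (x * u) - 1| * ((1 - u) / u)
      ≤ (|x * u| * Real.exp |x * u|) * ((1 - u) / u) := by
        refine mul_le_mul_of_nonneg_right (abs_exp_sub_one_le_mul_exp _) ?_
        exact div_nonneg (by linarith [hu.2]) hu.1.le
    _ = |x| * Real.exp |x * u| * (1 - u) := by
        rw [abs_mul, abs_of_pos hu.1]
        field_simp
    _ ≤ |x| * Real.exp |x| * 1 := by
        have : 0 ≤ 1 - u := by linarith [hu.2]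
        gcongr
        linarith
    _ = _ := mul_one _

/-- Obtained by integrating the derivative of `exp (x u) (1 - u)` over `[0, 1]`. With
`hasDerivAt_integral_expKernel` it says `x Φ'(x) = unifMGF x - 1`, where `Φ` is the integral in
`phi`. -/
lemma mul_integral_exp_mul_one_sub (x : ℝ) :
    x * ∫ u in (0 : ℝ)..1, Real.exp (x * u) * (1 - u) = unifMGF x - 1 := by
  have hder : ∀ u ∈ Set.uIcc (0 : ℝ) 1, HasDerivAt (fun u : ℝ => Real.exp (x * u) * (1 - u))
      (x * (Real.exp (x * u) * (1 - u)) - Real.exp (x * u)) u := by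
    intro u _
    have h1 : HasDerivAt (fun u : ℝ => Real.exp (x * u)) (Real.exp (x * u) * x) u := by
      simpa using ((hasDerivAt_id u).const_mul x).exp
    have h2 : HasDerivAt (fun u : ℝ => 1 - u) (-1) u := by
      simpa using (hasDerivAt_id u).const_sub 1
    exact (h1.mul h2).congr_deriv (by ring)
  have h := intervalIntegral.integral_eq_sub_of_hasDerivAt hder
    (Continuous.intervalIntegrable (by fun_prop) _ _)
  rw [intervalIntegral.integral_sub (Continuous.intervalIntegrable (by fun_prop) _ _)
    (Continuous.intervalIntegrable (by fun_prop) _ _), intervalIntegral.integral_const_mul] at h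
  simp only [mul_zero, Real.exp_zero, sub_self, sub_zero, mul_one] at h
  change _ - unifMGF x = _ at h
  linarith

/-- Differentiation under the integral: the factor `u` it produces cancels the singular `1 / u` of
the kernel. -/
lemma hasDerivAt_integral_expKernel (x : ℝ) :
    HasDerivAt (fun y : ℝ => ∫ u in (0 : ℝ)..1, (Real.exp (y * u) - 1) * ((1 - u) / u))
      (∫ u in (0 : ℝ)..1, Real.exp (x * u) * (1 - u)) x := by
  refine (intervalIntegral.hasDerivAt_integral_of_dominated_loc_of_deriv_le
    (F' := fun y u => Real.exp (y * u) * (1 - u)) (bound := fun _ => Real.exp (|x| + 1))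
    (Metric.ball_mem_nhds x one_pos) ?_ (intervalIntegrable_expKernel x) ?_ ?_ ?_ ?_).2
  · exact Eventually.of_forall fun y => Measurable.aestronglyMeasurable (by fun_prop)
  · exact Measurable.aestronglyMeasurable (by fun_prop)
  · refine ae_of_all _ fun u hu y hy => ?_
    rw [Set.uIoc_of_le zero_le_one] at hu
    have hy' : |y| ≤ |x| + 1 := by
      rw [Metric.mem_ball, Real.dist_eq] at hy
      have := abs_sub_abs_le_abs_sub y x
      linarith
    have hyu : y * u ≤ |x| + 1 := by
      refine (le_abs_self _).trans ?_
      rw [abs_mul, abs_of_pos hu.1]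
      exact (mul_le_of_le_one_right (abs_nonneg _) hu.2).trans hy'
    rw [norm_mul, Real.norm_eq_abs, Real.norm_eq_abs, Real.abs_exp,
      abs_of_nonneg (by linarith [hu.2])]
    calc Real.exp (y * u) * (1 - u) ≤ Real.exp (y * u) * 1 := by
          gcongr
          linarith [hu.1]
      _ ≤ Real.exp (|x| + 1) := by
          rw [mul_one]
          exact Real.exp_le_exp.2 hyu
  · simp
  · refine ae_of_all _ fun u hu y _ => ?_
    rw [Set.uIoc_of_le zero_le_one] at hu
    have h1 : HasDerivAt (fun y : ℝ => Real.exp (y * u)) (Real.exp (y * u) * u) y := by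
      simpa using ((hasDerivAt_id y).mul_const u).exp
    have := hu.1.ne'
    exact ((h1.sub_const 1).mul_const ((1 - u) / u)).congr_deriv (by field_simp)

/-- The exponent `φ_α` in terms of the moment generating function of the uniform law. -/
lemma integral_unifMGF_eq_phi (hα : 0 < α) (x : ℝ) :
    ∫ u in (0 : ℝ)..1, (α + 1) * u⁻¹ * (unifMGF (x * u ^ α) - 1) = phi α x := by
  set Φ : ℝ → ℝ := fun y => ∫ u in (0 : ℝ)..1, (Real.exp (y * u) - 1) * ((1 - u) / u) with hΦ
  have hcont : Continuous Φ :=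
    continuous_iff_continuousAt.2 fun y => (hasDerivAt_integral_expKernel y).continuousAt
  have hder : ∀ v ∈ Set.Ioo (0 : ℝ) 1, HasDerivAt (fun v : ℝ => Φ (x * v ^ α))
      (α * (v⁻¹ * (unifMGF (x * v ^ α) - 1))) v := by
    intro v hv
    have h1 : HasDerivAt (fun v : ℝ => x * v ^ α) (x * (α * v ^ (α - 1))) v :=
      (Real.hasDerivAt_rpow_const (Or.inl hv.1.ne')).const_mul x
    have h2 := (hasDerivAt_integral_expKernel (x * v ^ α)).comp v h1
    refine h2.congr_deriv ?_
    rw [← mul_integral_exp_mul_one_sub, Real.rpow_sub_one hv.1.ne']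
    ring
  have hint : IntervalIntegrable (fun v : ℝ => α * (v⁻¹ * (unifMGF (x * v ^ α) - 1))) volume 0 1 := by
    refine IntervalIntegrable.const_mul ?_ α
    refine ((intervalIntegrable_rpow_sub_one hα).const_mul (|x| * Real.exp |x|)).mono_fun' ?_ ?_
    · have := continuous_unifMGF.measurable
      refine Measurable.aestronglyMeasurable (measurable_inv.mul (Measurable.sub_const ?_ 1))
      exact this.comp ((measurable_id.pow_const α).const_mul x)
    · filter_upwards [ae_restrict_mem measurableSet_uIoc] with v hv
      rw [Set.uIoc_of_le zero_le_one] at hv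
      have hv0 := hv.1
      have hvα : 0 < v ^ α := Real.rpow_pos_of_pos hv.1 α
      have hvα1 : v ^ α ≤ 1 := Real.rpow_le_one hv.1.le hv.2 hα.le
      have hxv : |x * v ^ α| ≤ |x| := by
        rw [abs_mul, abs_of_pos hvα]
        exact mul_le_of_le_one_right (abs_nonneg _) hvα1
      rw [norm_mul, Real.norm_eq_abs, Real.norm_eq_abs, abs_of_pos (inv_pos.2 hv.1),
        Real.rpow_sub_one hv.1.ne']
      calc v⁻¹ * |unifMGF (x * v ^ α) - 1| ≤ v⁻¹ * (|x * v ^ α| * Real.exp |x * v ^ α|) := by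
            gcongr
            exact abs_unifMGF_sub_one_le _
        _ ≤ v⁻¹ * (|x * v ^ α| * Real.exp |x|) := by gcongr
        _ = _ := by
            rw [abs_mul, abs_of_pos hvα]
            ring
  -- Differentiability is used on the open interval only, since `v ^ α` is not differentiable at `0`
  -- when `α < 1`.
  have hFTC := intervalIntegral.integral_eq_sub_of_hasDerivAt_of_le
    (f := fun v : ℝ => Φ (x * v ^ α)) zero_le_one
    ((hcont.comp (continuous_const.mul (Real.continuous_rpow_const hα.le))).continuousOn) hder hint
  have h0 : Φ 0 = 0 := by simp [hΦ]
  rw [intervalIntegral.integral_const_mul] at hFTC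
  simp only [Real.one_rpow, mul_one, Real.zero_rpow hα.ne', mul_zero, h0,
    sub_zero] at hFTC
  simp only [mul_assoc]
  rw [intervalIntegral.integral_const_mul, phi]
  change _ = _ * Φ x
  rw [← hFTC]
  field_simp

/-- For `i` near `u n`, `n p_i → (α + 1) / u` and `a_i / S_n → α u^α`. The sum of logarithms is then
a Riemann sum for the integral computed in `integral_unifMGF_eq_phi`, at `x = α t`. -/
lemma tendsto_heightMGF_of_pos (hα : 0 < α) (ha : ∀ n, 1 ≤ n → 0 < a n)
    (h : RegularlyVarying a α) (t : ℝ) :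
    Tendsto (fun n => heightMGF a n (t / weightedSum a n)) atTop
      (𝓝 (Real.exp (phi α (α * t)))) := by
  have hpos : ∀ n : ℕ, 1 ≤ n → (0 : ℝ) < n := fun n hn => by exact_mod_cast hn
  set ρ := min (α / 2) 1
  have hρ : ρ < α := (min_le_left _ _).trans_lt (by linarith)
  have hρ0 : 0 < ρ := lt_min (by linarith) one_pos
  obtain ⟨C₁, hC₁, hpotter⟩ := h.exists_div_le_rpow hρ ha
  obtain ⟨C₂, hC₂, hlast⟩ := h.exists_lastProb_le hα.le ha
  have hlimS : Tendsto (fun n => a n / weightedSum a n) atTop (𝓝 α) := by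
    have := (h.tendsto_weightedSum_div hα ha).inv₀ (inv_ne_zero hα.ne')
    simpa using this
  obtain ⟨C₃, hC₃⟩ := hlimS.bddAbove_range
  have hC₃' : ∀ n, a n / weightedSum a n ≤ C₃ := fun n => hC₃ ⟨n, rfl⟩
  have hC₃0 : 0 < C₃ :=
    (div_pos (ha 1 le_rfl) (weightedSum_pos ha le_rfl)).trans_le (hC₃' 1)
  obtain ⟨B, hB, hlog⟩ := exists_abs_log_le (|t| * (C₁ * C₃))
  have hratio : ∀ n i : ℕ, 1 ≤ i → i ≤ n →
      |t / weightedSum a n * a i| ≤ |t| * (C₁ * C₃) * ((i : ℝ) / n) ^ ρ := by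
    intro n i hi hin
    have hn := hi.trans hin
    have hS := weightedSum_pos ha hn
    have hi' := ha i hi
    have hn' := ha n hn
    have h0 := hpos i hi
    have h1 := hpos n hn
    rw [abs_mul, abs_div, abs_of_pos hS, abs_of_pos hi']
    calc |t| / weightedSum a n * a i = |t| * ((a i / a n) * (a n / weightedSum a n)) := by
          field_simp
      _ ≤ |t| * ((C₁ * ((i : ℝ) / n) ^ ρ) * C₃) := by
          gcongr
          · exact hpotter n i hi hin
          · exact hC₃' n
      _ = _ := by ring
  have hsum := tendsto_sum_div (γ := ρ) (C := B * C₂ * (|t| * (C₁ * C₃)))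
    (x := fun n i => n * Real.log (1 + lastProb a i * (unifMGF (t / weightedSum a n * a i) - 1)))
    (L := fun u => (α + 1) * u⁻¹ * (unifMGF (α * t * u ^ α) - 1)) hρ0 (min_le_right _ _)
    (fun n i hi hin => by
      have h0 := hpos i hi
      have h1 := hpos n (hi.trans hin)
      have hle1 : ((i : ℝ) / n) ^ ρ ≤ 1 :=
        Real.rpow_le_one (by positivity) (div_le_one_of_le₀ (by exact_mod_cast hin) h1.le) hρ0.le
      have hK : |t / weightedSum a n * a i| ≤ |t| * (C₁ * C₃) :=
        (hratio n i hi hin).trans (mul_le_of_le_one_right (by positivity) hle1)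
      rw [abs_mul, abs_of_pos h1, Real.rpow_sub_one (by positivity)]
      calc (n : ℝ) * |Real.log (1 + lastProb a i * (unifMGF (t / weightedSum a n * a i) - 1))|
          ≤ n * (B * (lastProb a i * |t / weightedSum a n * a i|)) := by
            gcongr
            exact hlog _ _ (lastProb_nonneg ha hi) (lastProb_le_one ha hi) hK
        _ ≤ n * (B * (C₂ * (i : ℝ)⁻¹ * (|t| * (C₁ * C₃) * ((i : ℝ) / n) ^ ρ))) := by
            gcongr
            · exact hlast i hi
            · exact hratio n i hi hin
        _ = _ := by field_simp)
    (fun u hu _ => by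
      -- It suffices to find the limit of `n * x_n` in `n * log (1 + x_n)`.
      refine Real.tendsto_nat_mul_log_one_add_of_tendsto ?_
      have hi : Tendsto (fun n : ℕ => ⌊u * n⌋₊ + 1) atTop atTop :=
        (tendsto_add_atTop_nat 1).comp (tendsto_floor_mul_atTop hu)
      have h1 := (h.tendsto_mul_lastProb hα.le ha).comp hi
      have h2 : Tendsto (fun n : ℕ => ((⌊u * n⌋₊ + 1 : ℕ) : ℝ) / n) atTop (𝓝 u) := by
        have h1 := (tendsto_floor_mul_div hu).add tendsto_inv_atTop_nhds_zero_nat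
        rw [add_zero] at h1
        refine h1.congr fun n => ?_
        push_cast
        ring
      have h3 : Tendsto (fun n : ℕ => t / weightedSum a n * a (⌊u * n⌋₊ + 1)) atTop
          (𝓝 (α * t * u ^ α)) := by
        have h4 := ((h.tendsto_floor_succ ha hu).mul hlimS).const_mul t
        rw [show t * (u ^ α * α) = α * t * u ^ α by ring] at h4
        refine h4.congr' ?_
        filter_upwards [eventually_ge_atTop 1] with n hn
        have := ha n hn
        have := weightedSum_pos ha hn
        field_simp
      have h4 := ((continuous_unifMGF.tendsto _).comp h3).sub_const 1
      refine ((h1.mul (h2.inv₀ hu.ne')).mul h4).congr' ?_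
      filter_upwards [eventually_ge_atTop 1] with n hn
      have := hpos n hn
      have : ((⌊u * n⌋₊ + 1 : ℕ) : ℝ) ≠ 0 := by positivity
      simp only [Function.comp]
      field_simp)
  rw [integral_unifMGF_eq_phi hα] at hsum
  refine ((Real.continuous_exp.tendsto _).comp hsum).congr' ?_
  filter_upwards [eventually_ge_atTop 1] with n hn
  have hn' := (hpos n hn).ne'
  rw [← exp_sum_log_eq_heightMGF ha, Function.comp, ← Finset.mul_sum, mul_div_cancel_left₀ _ hn']

/-! #### Index zero -/

lemma sum_range_succ_eq_sum_Icc {f : ℕ → ℝ} (hf : f 0 = 0) (n : ℕ) :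
    ∑ i ∈ Finset.range (n + 1), f i = ∑ i ∈ Finset.Icc 1 n, f i := by
  rw [Finset.range_eq_Ico, Finset.sum_eq_sum_Ico_succ_bot (by omega), hf, zero_add]
  rfl

lemma tendsto_weightedSum_atTop (ha : ∀ n, 1 ≤ n → 0 < a n)
    (hS : ¬ Summable fun i : ℕ => (i : ℝ)⁻¹ * a i) : Tendsto (weightedSum a) atTop atTop := by
  rw [not_summable_iff_tendsto_nat_atTop_of_nonneg] at hS
  · refine (hS.comp (tendsto_add_atTop_nat 1)).congr fun n => ?_
    exact sum_range_succ_eq_sum_Icc (by simp) n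
  · intro i
    rcases Nat.eq_zero_or_pos i with rfl | hi
    · simp
    · have := ha i hi
      positivity

/-- Here `n p_n → 1`, so `p_i a_i ~ a_i / i`. Equivalence of the terms passes to partial sums
because the series diverges. -/
lemma tendsto_sum_lastProb_mul_div (ha : ∀ n, 1 ≤ n → 0 < a n) (h : RegularlyVarying a 0)
    (hS : ¬ Summable fun i : ℕ => (i : ℝ)⁻¹ * a i) :
    Tendsto (fun n => (∑ i ∈ Finset.Icc 1 n, lastProb a i * a i) / weightedSum a n) atTop
      (𝓝 1) := by
  have hnonneg : (0 : ℕ → ℝ) ≤ fun i : ℕ => (i : ℝ)⁻¹ * a i := by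
    intro i
    rcases Nat.eq_zero_or_pos i with rfl | hi
    · simp
    · have := ha i hi
      simp only [Pi.zero_apply]
      positivity
  have hlittle : (fun i : ℕ => lastProb a i * a i - (i : ℝ)⁻¹ * a i) =o[atTop]
      fun i : ℕ => (i : ℝ)⁻¹ * a i := by
    have h1 : Tendsto (fun n : ℕ => n * lastProb a n - 1) atTop (𝓝 0) := by
      simpa using (h.tendsto_mul_lastProb le_rfl ha).sub_const 1
    refine (((Asymptotics.isLittleO_one_iff ℝ).2 h1).mul_isBigO
      (Asymptotics.isBigO_refl (fun i : ℕ => (i : ℝ)⁻¹ * a i) atTop)).congr' ?_ ?_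
    · filter_upwards [eventually_gt_atTop 0] with n hn
      have : (n : ℝ) ≠ 0 := by exact_mod_cast hn.ne'
      field_simp
    · simp
  have hsum := hlittle.sum_range hnonneg ((not_summable_iff_tendsto_nat_atTop_of_nonneg hnonneg).1 hS)
  have hdiv := (hsum.tendsto_div_nhds_zero.comp (tendsto_add_atTop_nat 1)).add_const 1
  rw [zero_add] at hdiv
  refine hdiv.congr' ?_
  filter_upwards [eventually_ge_atTop 1] with n hn
  have hpos := weightedSum_pos ha hn
  simp only [Function.comp]
  rw [Finset.sum_sub_distrib,
    sum_range_succ_eq_sum_Icc (f := fun i => lastProb a i * a i) (by simp [lastProb, totalLength]),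
    sum_range_succ_eq_sum_Icc (f := fun i : ℕ => (i : ℝ)⁻¹ * a i) (by simp)]
  change (_ - weightedSum a n) / weightedSum a n + 1 = _
  field_simp
  ring

/-- For large `i`, `a_i ≤ ε S_i ≤ ε S_n`; the finitely many remaining `a_i` are beaten by `S_n → ∞`.
-/
lemma eventually_forall_le_mul_weightedSum (ha : ∀ n, 1 ≤ n → 0 < a n)
    (h : RegularlyVarying a 0) (hS : ¬ Summable fun i : ℕ => (i : ℝ)⁻¹ * a i) {ε : ℝ}
    (hε : 0 < ε) : ∀ᶠ n in atTop, ∀ i ∈ Finset.Icc 1 n, a i ≤ ε * weightedSum a n := by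
  obtain ⟨N, hN⟩ := eventually_atTop.1
    ((h.tendsto_div_weightedSum_zero ha).eventually_le_const hε)
  obtain ⟨M, hM⟩ := ((Finset.range N).image a).bddAbove
  have hlarge : ∀ᶠ n in atTop, M ≤ ε * weightedSum a n :=
    ((tendsto_weightedSum_atTop ha hS).const_mul_atTop hε).eventually_ge_atTop M
  filter_upwards [hlarge] with n hn i hi
  rw [Finset.mem_Icc] at hi
  rcases lt_or_ge i N with hiN | hiN
  · exact (hM (by simpa using ⟨i, hiN, rfl⟩)).trans hn
  · have h1 := hN i hiN
    rw [div_le_iff₀ (weightedSum_pos ha hi.1)] at h1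
    exact h1.trans (mul_le_mul_of_nonneg_left (weightedSum_mono ha hi.2) hε.le)

/-- A law of large numbers: the linear terms sum to `(t / 2) ∑ p_i a_i / S_n → t / 2`. The quadratic
errors are at most a constant times `max_i (a_i / S_n) * ∑ p_i a_i / S_n`, which vanishes. -/
lemma tendsto_heightMGF_of_not_summable (ha : ∀ n, 1 ≤ n → 0 < a n) (h : RegularlyVarying a 0)
    (hS : ¬ Summable fun i : ℕ => (i : ℝ)⁻¹ * a i) (t : ℝ) :
    Tendsto (fun n => heightMGF a n (t / weightedSum a n)) atTop (𝓝 (Real.exp (t / 2))) := by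
  obtain ⟨B, hB, hlog⟩ := exists_abs_log_sub_le |t|
  have hmean := tendsto_sum_lastProb_mul_div ha h hS
  have hdiff : Tendsto (fun n => (∑ i ∈ Finset.Icc 1 n,
        Real.log (1 + lastProb a i * (unifMGF (t / weightedSum a n * a i) - 1))) -
      t / 2 * ((∑ i ∈ Finset.Icc 1 n, lastProb a i * a i) / weightedSum a n)) atTop (𝓝 0) := by
    rw [Metric.tendsto_atTop']
    suffices hsuff : ∀ ε > 0, ε ≤ 1 → ∀ᶠ n in atTop, |(∑ i ∈ Finset.Icc 1 n,
        Real.log (1 + lastProb a i * (unifMGF (t / weightedSum a n * a i) - 1))) -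
      t / 2 * ((∑ i ∈ Finset.Icc 1 n, lastProb a i * a i) / weightedSum a n)| ≤
        B * t ^ 2 * 2 * ε by
      intro ε hε
      have hpos : 0 < B * t ^ 2 * 2 + 1 := by positivity
      have hδ : 0 < min (ε / (B * t ^ 2 * 2 + 1)) 1 := by positivity
      obtain ⟨N, hN⟩ := eventually_atTop.1 (hsuff _ hδ (min_le_right _ _))
      refine ⟨N, fun n hn => ?_⟩
      rw [Real.dist_eq, sub_zero]
      refine (hN n hn.le).trans_lt ?_
      calc B * t ^ 2 * 2 * min (ε / (B * t ^ 2 * 2 + 1)) 1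
          < (B * t ^ 2 * 2 + 1) * min (ε / (B * t ^ 2 * 2 + 1)) 1 := by nlinarith
        _ ≤ (B * t ^ 2 * 2 + 1) * (ε / (B * t ^ 2 * 2 + 1)) := by
            gcongr
            exact min_le_left _ _
        _ = ε := by field_simp
    intro ε hε hε1
    filter_upwards [eventually_forall_le_mul_weightedSum ha h hS hε, eventually_ge_atTop 1,
      hmean.eventually_le_const one_lt_two] with n hmax hn hle2
    have hSn := weightedSum_pos ha hn
    rw [Finset.sum_div, Finset.mul_sum, ← Finset.sum_sub_distrib]
    calc |∑ i ∈ Finset.Icc 1 n,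
          (Real.log (1 + lastProb a i * (unifMGF (t / weightedSum a n * a i) - 1)) -
            t / 2 * (lastProb a i * a i / weightedSum a n))|
        ≤ ∑ i ∈ Finset.Icc 1 n, B * t ^ 2 * ε * (lastProb a i * a i / weightedSum a n) := by
          refine (Finset.abs_sum_le_sum_abs _ _).trans (Finset.sum_le_sum fun i hi => ?_)
          have hi1 := (Finset.mem_Icc.1 hi).1
          have hai := ha i hi1
          have hp := lastProb_nonneg ha hi1
          have hr : a i / weightedSum a n ≤ ε := by
            rw [div_le_iff₀ hSn]
            exact hmax i hi
          have hr0 : 0 ≤ a i / weightedSum a n := by positivity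
          have hx : |t / weightedSum a n * a i| ≤ |t| := by
            rw [show t / weightedSum a n * a i = t * (a i / weightedSum a n) by ring, abs_mul,
              abs_of_nonneg hr0]
            exact mul_le_of_le_one_right (abs_nonneg _) (hr.trans hε1)
          have h1 := hlog _ _ hp (lastProb_le_one ha hi1) hx
          rw [show lastProb a i * (t / weightedSum a n * a i / 2) =
            t / 2 * (lastProb a i * a i / weightedSum a n) by ring] at h1
          refine h1.trans ?_
          calc B * (lastProb a i * (t / weightedSum a n * a i) ^ 2)
              = B * t ^ 2 * (lastProb a i * (a i / weightedSum a n)) * (a i / weightedSum a n) := by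
                ring
            _ ≤ B * t ^ 2 * (lastProb a i * (a i / weightedSum a n)) * ε := by gcongr
            _ = _ := by ring
      _ = B * t ^ 2 * ε * ((∑ i ∈ Finset.Icc 1 n, lastProb a i * a i) / weightedSum a n) := by
          rw [← Finset.mul_sum, Finset.sum_div]
      _ ≤ B * t ^ 2 * ε * 2 := by gcongr
      _ = _ := by ring
  have hlim := hdiff.add (hmean.const_mul (t / 2))
  simp only [sub_add_cancel, zero_add, mul_one] at hlim
  refine ((Real.continuous_exp.tendsto _).comp hlim).congr fun n => ?_
  exact exp_sum_log_eq_heightMGF ha n t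

/-! ### Index zero with a convergent series -/

lemma tendsto_weightedSum_tsum (hS : Summable fun i : ℕ => (i : ℝ)⁻¹ * a i) :
    Tendsto (weightedSum a) atTop (𝓝 (∑' i : ℕ, (i : ℝ)⁻¹ * a i)) := by
  refine (hS.hasSum.tendsto_sum_nat.comp (tendsto_add_atTop_nat 1)).congr fun n => ?_
  exact sum_range_succ_eq_sum_Icc (by simp) n

/-- Dominated convergence for series: each logarithm converges since `S_n` does, and is at most a
constant times `p_i a_i`, hence times the summable `a_i / i`. -/
lemma exists_tendsto_heightMGF_of_summable (ha : ∀ n, 1 ≤ n → 0 < a n)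
    (h : RegularlyVarying a 0) (hS : Summable fun i : ℕ => (i : ℝ)⁻¹ * a i) (t : ℝ) :
    ∃ l, Tendsto (fun n => heightMGF a n (t / weightedSum a n)) atTop (𝓝 l) := by
  obtain ⟨C, hC, hlast⟩ := h.exists_lastProb_le le_rfl ha
  obtain ⟨C', hC'⟩ := (h.tendsto_div_weightedSum_zero ha).bddAbove_range
  obtain ⟨B, hB, hlog⟩ := exists_abs_log_le (|t| * C')
  have hlimS := tendsto_weightedSum_tsum hS
  have hS1 := weightedSum_pos ha le_rfl
  have hSpos : 0 < ∑' i : ℕ, (i : ℝ)⁻¹ * a i :=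
    hS1.trans_le ((weightedSum_mono ha).ge_of_tendsto hlimS 1)
  set f : ℕ → ℕ → ℝ := fun n i => if i ∈ Finset.Icc 1 n then
    Real.log (1 + lastProb a i * (unifMGF (t / weightedSum a n * a i) - 1)) else 0 with hf
  have htannery := tendsto_tsum_of_dominated_convergence (𝓕 := atTop) (f := f)
    (g := fun i => if 1 ≤ i then Real.log (1 + lastProb a i *
      (unifMGF (t / (∑' i : ℕ, (i : ℝ)⁻¹ * a i) * a i) - 1)) else 0)
    (bound := fun i : ℕ => B * C * (|t| / weightedSum a 1) * ((i : ℝ)⁻¹ * a i))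
    (hS.mul_left _) ?_ ?_
  · refine ⟨_, ((Real.continuous_exp.tendsto _).comp htannery).congr fun n => ?_⟩
    rw [← exp_sum_log_eq_heightMGF ha, Function.comp,
      tsum_eq_sum (s := Finset.Icc 1 n) (fun i hi => by simp only [hf, hi, if_false])]
    exact congrArg _ (Finset.sum_congr rfl fun i hi => by simp only [hf, hi, if_true])
  · intro i
    by_cases hi : 1 ≤ i
    · simp only [hi, if_true]
      have h1 : Tendsto (fun n => Real.log (1 + lastProb a i *
          (unifMGF (t / weightedSum a n * a i) - 1))) atTop
          (𝓝 (Real.log (1 + lastProb a i *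
            (unifMGF (t / (∑' i : ℕ, (i : ℝ)⁻¹ * a i) * a i) - 1)))) := by
        refine Tendsto.log (tendsto_const_nhds.add (Tendsto.const_mul _ (Tendsto.sub_const ?_ 1))) ?_
        · refine (continuous_unifMGF.tendsto _).comp (Tendsto.mul_const _ ?_)
          exact tendsto_const_nhds.div hlimS hSpos.ne'
        · exact (one_add_mul_unifMGF_pos (lastProb_nonneg ha hi) (lastProb_le_one ha hi) _).ne'
      refine h1.congr' ?_
      filter_upwards [eventually_ge_atTop i] with n hn
      simp [hf, hi, hn]
    · simp [hf, hi]
  · refine Eventually.of_forall fun n i => ?_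
    by_cases hi : i ∈ Finset.Icc 1 n
    · simp only [hf, hi, if_true, Real.norm_eq_abs]
      obtain ⟨hi1, hin⟩ := Finset.mem_Icc.1 hi
      have hai := ha i hi1
      have hSn := weightedSum_pos ha (hi1.trans hin)
      have hSi := weightedSum_pos ha hi1
      have hx : |t / weightedSum a n * a i| = |t| * (a i / weightedSum a n) := by
        rw [abs_mul, abs_div, abs_of_pos hSn, abs_of_pos hai]
        ring
      have hK : |t / weightedSum a n * a i| ≤ |t| * C' := by
        rw [hx]
        refine mul_le_mul_of_nonneg_left ?_ (abs_nonneg _)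
        refine (div_le_div_of_nonneg_left hai.le hSi (weightedSum_mono ha hin)).trans ?_
        exact hC' ⟨i, rfl⟩
      refine (hlog _ _ (lastProb_nonneg ha hi1) (lastProb_le_one ha hi1) hK).trans ?_
      rw [hx]
      have hi0 : (0 : ℝ) < i := by exact_mod_cast hi1
      calc B * (lastProb a i * (|t| * (a i / weightedSum a n)))
          ≤ B * (C * (i : ℝ)⁻¹ * (|t| * (a i / weightedSum a 1))) := by
            gcongr
            · exact hlast i hi1
            · exact weightedSum_mono ha (hi1.trans hin)
        _ = _ := by ring
    · simp only [hf, hi, if_false, norm_zero]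
      rcases Nat.eq_zero_or_pos i with rfl | hi1
      · simp
      · have := ha i hi1
        positivity

/-- Only the first factor is kept, where `lastProb a 1 = 1`; the others are at most `1` for `t ≤ 0`.
This bound, uniform in `n`, forces the limit to be positive in the summable case. -/
lemma heightMGF_le_of_nonpos (ha : ∀ n, 1 ≤ n → 0 < a n) {n : ℕ} (hn : 1 ≤ n) {t : ℝ}
    (ht : t ≤ 0) : heightMGF a n t ≤ unifMGF (t * a 1) := by
  have hmem : 1 ∈ Finset.Icc 1 n := by simp [hn]
  rw [heightMGF, ← Finset.mul_prod_erase _ _ hmem, lastProb_one ha, one_mul, add_sub_cancel]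
  refine mul_le_of_le_one_right (unifMGF_pos _).le (Finset.prod_le_one (fun i hi => ?_) fun i hi => ?_)
  · have hi1 := (Finset.mem_Icc.1 (Finset.mem_of_mem_erase hi)).1
    exact (one_add_mul_unifMGF_pos (lastProb_nonneg ha hi1) (lastProb_le_one ha hi1) _).le
  · have hi1 := (Finset.mem_Icc.1 (Finset.mem_of_mem_erase hi)).1
    have h1 : unifMGF (t * a i) ≤ 1 := by
      rw [← unifMGF_zero]
      exact unifMGF_mono (mul_nonpos_of_nonpos_of_nonneg ht (ha i hi1).le)
    nlinarith [lastProb_nonneg ha hi1]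

lemma tendsto_unifMGF_atBot : Tendsto unifMGF atBot (𝓝 0) := by
  have h : Tendsto (fun x : ℝ => (Real.exp x - 1) * x⁻¹) atBot (𝓝 ((0 - 1) * 0)) :=
    (Real.tendsto_exp_atBot.sub_const 1).mul tendsto_inv_atBot_zero
  rw [mul_zero] at h
  refine h.congr' ?_
  filter_upwards [eventually_lt_atBot 0] with x hx
  rw [← mul_unifMGF]
  have := hx.ne
  field_simp

end

/-! ### Limits of the heights -/

section

variable {Ω : Type*} [MeasurableSpace Ω] {P : Measure Ω}
  {a : ℕ → ℝ} {Y X : ℕ → Ω → Pt}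

lemma aemeasurable_height_div (hX : ∀ n, 1 ≤ n → UniformOnTree a P Y n (X n)) (n : ℕ) :
    AEMeasurable (fun ω => height Y X n ω / weightedSum a n) P := by
  rcases Nat.eq_zero_or_pos n with rfl | hn
  · simpa only [height, treeDist] using aemeasurable_const
  · exact (hX n hn).aemeasurable_height.div_const _

/-- The rescaled heights converge in distribution as soon as their moment generating functions
converge. -/
lemma exists_tendstoInDistribution_height [IsProbabilityMeasure P]
    (ha : ∀ n, 1 ≤ n → 0 < a n) (hY : IsGluing a P Y)
    (hX : ∀ n, 1 ≤ n → UniformOnTree a P Y n (X n)) {M : ℝ → ℝ}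
    (hM : ∀ t, Tendsto (fun n => heightMGF a n (t / weightedSum a n)) atTop (𝓝 (M t))) :
    ∃ ν : ProbabilityMeasure ℝ,
      TendstoInDistribution (fun (n : ℕ) (ω : Ω) => height Y X n ω / weightedSum a n)
        atTop (fun x : ℝ => x) (fun _ => P) (ν : Measure ℝ) ∧
      ∀ t, Integrable (fun x : ℝ => Real.exp (t * x)) (ν : Measure ℝ) ∧
        mgf id (ν : Measure ℝ) t = M t := by
  have hmeas := aemeasurable_height_div hX
  set μ : ℕ → ProbabilityMeasure ℝ := fun n =>
    ⟨P.map fun ω => height Y X n ω / weightedSum a n, Measure.isProbabilityMeasure_map (hmeas n)⟩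
  have hint : ∀ n t, Integrable (fun x : ℝ => Real.exp (t * x)) (μ n : Measure ℝ) := by
    intro n t
    change Integrable (fun x : ℝ => Real.exp (t * x)) (P.map _)
    rw [integrable_map_measure (by fun_prop) (hmeas n)]
    -- The hypotheses start at `n = 1`; at `n = 0` the height is `0` by the default value of
    -- `treeDist`.
    rcases Nat.eq_zero_or_pos n with rfl | hn
    · simp [Function.comp_def, height, treeDist]
    · refine (integrable_exp_height ha hY (t / weightedSum a n) hn (hX n hn)).1.congr
        (ae_of_all _ fun ω => ?_)
      simp only [Function.comp, height]
      congr 1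
      ring
  have hmgf : ∀ t, ∀ n, 1 ≤ n →
      heightMGF a n (t / weightedSum a n) = mgf id (μ n : Measure ℝ) t := by
    intro t n hn
    change _ = mgf id (P.map _) t
    rw [mgf_id_map (hmeas n), ← (integrable_exp_height ha hY _ hn (hX n hn)).2, mgf]
    refine integral_congr_ae (ae_of_all _ fun ω => ?_)
    simp only [height]
    congr 1
    ring
  obtain ⟨ν, hν, hνM⟩ := exists_tendsto_of_tendsto_mgf hint fun t => (hM t).congr' (by
    filter_upwards [eventually_ge_atTop 1] with n hn using hmgf t n hn)
  refine ⟨ν, ⟨hmeas, aemeasurable_id', ?_⟩, hνM⟩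
  have hid : (⟨(ν : Measure ℝ).map fun x => x,
      Measure.isProbabilityMeasure_map aemeasurable_id'⟩ : ProbabilityMeasure ℝ) = ν :=
    Subtype.ext Measure.map_id'
  rw [hid]
  exact hν

lemma IsXiLaw.integrable_exp {α : ℝ} {ν : ProbabilityMeasure ℝ} (h : IsXiLaw α ν) (t : ℝ) :
    Integrable (fun x : ℝ => Real.exp (t * x)) (ν : Measure ℝ) := by
  have : 0 < mgf id (ν : Measure ℝ) t := by
    rw [h t]
    exact Real.exp_pos _
  exact mgf_pos_iff.1 this

lemma IsXiLaw.eq {α : ℝ} {ν ν' : ProbabilityMeasure ℝ} (h : IsXiLaw α ν) (h' : IsXiLaw α ν') :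
    ν = ν' := by
  have heq : (ν : Measure ℝ) = (ν' : Measure ℝ) :=
    measure_eq_of_mgf_eq h.integrable_exp fun t => (h t).trans (h' t).symm
  exact Subtype.ext heq

lemma mgf_id_map_const_mul (ν : Measure ℝ) (c t : ℝ) :
    mgf id (ν.map fun x => c * x) t = mgf id ν (c * t) := by
  rw [mgf_id_map (by fun_prop)]
  simp only [mgf, id]
  congr with x
  ring_nf

/-- Convergence in distribution to a constant implies convergence in probability. -/
lemma tendstoInMeasure_of_tendstoInDistribution_const [IsProbabilityMeasure P]
    {Z : ℕ → Ω → ℝ} {c : ℝ}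
    {ν : ProbabilityMeasure ℝ} (hν : (ν : Measure ℝ) = Measure.dirac c)
    (h : TendstoInDistribution Z atTop (fun x : ℝ => x) (fun _ => P) (ν : Measure ℝ)) :
    TendstoInMeasure P Z atTop (fun _ => c) := by
  rw [tendstoInMeasure_iff_dist]
  intro ε hε
  have hclosed : IsClosed {x : ℝ | ε ≤ dist x c} :=
    isClosed_le continuous_const (continuous_id.dist continuous_const)
  -- The frontier lies in the closed set itself, which misses `c`, so the portmanteau theorem
  -- applies.
  have hnull : (ν : Measure ℝ).map (fun x : ℝ => x) (frontier {x : ℝ | ε ≤ dist x c}) = 0 := by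
    refine measure_mono_null (hclosed.frontier_subset) ?_
    rw [Measure.map_id', hν, Measure.dirac_apply' _ hclosed.measurableSet]
    simp [hε]
  have hlim := ProbabilityMeasure.tendsto_measure_of_null_frontier_of_tendsto' h.tendsto hnull
  have hzero : (ν : Measure ℝ).map (fun x : ℝ => x) {x : ℝ | ε ≤ dist x c} = 0 := by
    rw [Measure.map_id', hν, Measure.dirac_apply' _ hclosed.measurableSet]
    simp [hε]
  simp only [ProbabilityMeasure.coe_mk, hzero] at hlim
  refine hlim.congr fun n => ?_
  rw [Measure.map_apply_of_aemeasurable (h.forall_aemeasurable n) hclosed.measurableSet]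
  rfl

end

end SegmentGluing

/-! ### The three regimes -/

open SegmentGluing in
theorem mainTheorem3
    {Ω : Type*} [MeasurableSpace Ω] (P : Measure Ω) [IsProbabilityMeasure P]
    (a : ℕ → ℝ) (ha : ∀ n, 1 ≤ n → 0 < a n)
    (α : ℝ) (hα : 0 ≤ α) (hreg : SegmentGluing.RegularlyVarying a α)
    (Y : ℕ → Ω → SegmentGluing.Pt) (hY : SegmentGluing.IsGluing a P Y)
    (X : ℕ → Ω → SegmentGluing.Pt)
    (hX : ∀ n, 1 ≤ n → SegmentGluing.UniformOnTree a P Y n (X n)) :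
    (0 < α →
      (∃! ν : ProbabilityMeasure ℝ, SegmentGluing.IsXiLaw α ν) ∧
      ∀ ν : ProbabilityMeasure ℝ, SegmentGluing.IsXiLaw α ν →
        TendstoInDistribution
          (fun (n : ℕ) (ω : Ω) => SegmentGluing.height Y X n ω / SegmentGluing.weightedSum a n)
          atTop (fun x : ℝ => α * x) (fun _ => P) (ν : Measure ℝ)) ∧
    (α = 0 → ¬ Summable (fun i : ℕ => (i : ℝ)⁻¹ * a i) →
      TendstoInMeasure P
        (fun (n : ℕ) (ω : Ω) => SegmentGluing.height Y X n ω / SegmentGluing.weightedSum a n)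
        atTop (fun _ => 1 / 2)) ∧
    (α = 0 → Summable (fun i : ℕ => (i : ℝ)⁻¹ * a i) →
      ∃ ν : ProbabilityMeasure ℝ,
        (∀ᵐ x ∂(ν : Measure ℝ), 0 < x) ∧ Integrable (fun x : ℝ => x) (ν : Measure ℝ) ∧
        TendstoInDistribution
          (fun (n : ℕ) (ω : Ω) => SegmentGluing.height Y X n ω / SegmentGluing.weightedSum a n)
          atTop (fun x : ℝ => x) (fun _ => P) (ν : Measure ℝ)) := by
  refine ⟨fun hpos => ?_, ?_, ?_⟩
  · obtain ⟨ν₀, hν₀, hmgf⟩ := exists_tendstoInDistribution_height ha hY hX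
      (tendsto_heightMGF_of_pos hpos ha hreg)
    -- The limit `ν₀` of the rescaled heights has generating function `exp (φ_α (α t))`, so dividing
    -- by `α` gives the law of `ξ_(α)`. Its existence is thus a consequence of the convergence.
    refine ⟨⟨⟨(ν₀ : Measure ℝ).map fun x => α⁻¹ * x,
      Measure.isProbabilityMeasure_map (by fun_prop)⟩, fun t => ?_, fun ν' hν' => ?_⟩, ?_⟩
    · change mgf id ((ν₀ : Measure ℝ).map fun x => α⁻¹ * x) t = _
      rw [mgf_id_map_const_mul, (hmgf _).2, mul_inv_cancel_left₀ hpos.ne']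
    · refine hν'.eq fun t => ?_
      change mgf id ((ν₀ : Measure ℝ).map fun x => α⁻¹ * x) t = _
      rw [mgf_id_map_const_mul, (hmgf _).2, mul_inv_cancel_left₀ hpos.ne']
    · intro ν hν
      have := Measure.isProbabilityMeasure_map (μ := (ν : Measure ℝ)) (f := fun x => α * x)
        (by fun_prop)
      have heq : (ν₀ : Measure ℝ) = (ν : Measure ℝ).map fun x => α * x :=
        measure_eq_of_mgf_eq (fun t => (hmgf t).1) fun t => by
          rw [(hmgf t).2, mgf_id_map_const_mul, hν]
      refine ⟨hν₀.forall_aemeasurable, by fun_prop, ?_⟩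
      have hmap : (ν : Measure ℝ).map (fun x => α * x) = (ν₀ : Measure ℝ).map fun x => x :=
        heq.symm.trans Measure.map_id'.symm
      simpa only [hmap] using hν₀.tendsto
  · rintro rfl hS
    obtain ⟨ν, hν, hmgf⟩ := exists_tendstoInDistribution_height ha hY hX
      (tendsto_heightMGF_of_not_summable ha hreg hS)
    refine tendstoInMeasure_of_tendstoInDistribution_const ?_ hν
    refine measure_eq_of_mgf_eq (fun t => (hmgf t).1) fun t => ?_
    rw [(hmgf t).2, mgf_dirac', id, mul_one_div]
  · rintro rfl hS
    choose M hM using exists_tendsto_heightMGF_of_summable ha hreg hS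
    obtain ⟨ν, hν, hmgf⟩ := exists_tendstoInDistribution_height ha hY hX hM
    have huniv : integrableExpSet (fun x : ℝ => x) (ν : Measure ℝ) = Set.univ := by
      ext t
      simpa [integrableExpSet] using (hmgf t).1
    refine ⟨ν, ?_, integrable_of_mem_interior_integrableExpSet (by simp [huniv]), hν⟩
    have hlimS := tendsto_weightedSum_tsum hS
    set S := ∑' i : ℕ, (i : ℝ)⁻¹ * a i
    have hSpos : 0 < S :=
      (weightedSum_pos ha le_rfl).trans_le ((weightedSum_mono ha).ge_of_tendsto hlimS 1)
    -- Chernoff's bound at level `0`; letting `t → -∞` then shows that the limit law gives no mass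
    -- to `(-∞, 0]`.
    have hbound : ∀ t ≤ 0, (ν : Measure ℝ).real {x : ℝ | id x ≤ 0} ≤ unifMGF (t / S * a 1) := by
      intro t ht
      have h1 := measure_le_le_exp_mul_mgf (μ := (ν : Measure ℝ)) (X := id) 0 ht (hmgf t).1
      rw [mul_zero, Real.exp_zero, one_mul, (hmgf t).2] at h1
      refine h1.trans (le_of_tendsto_of_tendsto (hM t)
        ((continuous_unifMGF.tendsto _).comp
          ((tendsto_const_nhds.div hlimS hSpos.ne').mul_const (a 1))) ?_)
      filter_upwards [eventually_ge_atTop 1] with n hn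
      exact heightMGF_le_of_nonpos ha hn (div_nonpos_of_nonpos_of_nonneg ht (weightedSum_pos ha hn).le)
    have hzero : (ν : Measure ℝ).real {x : ℝ | id x ≤ 0} ≤ 0 := by
      have hbot : Tendsto (fun t : ℝ => t / S * a 1) atBot atBot :=
        (tendsto_id.atBot_div_const hSpos).atBot_mul_const (ha 1 le_rfl)
      refine ge_of_tendsto (tendsto_unifMGF_atBot.comp hbot) ?_
      filter_upwards [eventually_le_atBot 0] with t ht using hbound t ht
    have hnull := (measureReal_eq_zero_iff).1 (le_antisymm hzero measureReal_nonneg)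
    rw [ae_iff]
    simpa only [not_lt, id] using hnull
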